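/- Let $C=\mathbb{P}^1/(0,1,\infty)$ be the complex curve obtained from $\mathbb{P}^1$ by gluing $0,1,\infty$ to one point $\tau$: with $\pi:\mathbb{P}^1\to C$ the projection, $C$ carries the quotient of the Zariski topology, and the regular functions on an open $U\subset C$ are the regular functions on $\pi^{-1}(U)$ taking equal values at $0,1,\infty$ (if $\tau\in U$). A line bundle $L$ on $C$ has degree $d$ if $\pi^*L$ has degree $d$. Let $\mathcal{O}(-1)\subset\mathbb{P}^1\times\mathbb{C}^2$ be the tautological bundle, and choose bases $b_0,b_1,b_\infty$ of its fibres at $0,1,\infty$. If $L$ has degree $-1$, choose an isomorphism $\pi^*L\simeq\mathcal{O}(-1)$ and a nonzero vector of the fibre $L_\tau$. Its images in the fibres of $\mathcal{O}(-1)$ at $0,1,\infty$ have the form $a_0b_0,\ a_1b_1,\ a_\infty b_\infty$. Then: 1. The point $[a_0:a_1:a_\infty]\in\mathbb{P}^2$ depends only on $L$, and $L\mapsto[a_0:a_1:a_\infty]$ is a bijection from the set of isomorphism classes of line bundles of degree $-1$ on $C$ onto $M_O=(\mathbb{C}^*)^3/\mathbb{C}^*\subset\mathbb{P}^2$. 2.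 For $L$ of degree $-1$ there is at most one smooth point $x\in C\setminus\{\tau\}$ with $L(x)=L\otimes\mathcal{O}(x)\simeq\mathcal{O}_C$. 3. There is an irreducible quadric (conic) $Z\subset\mathbb{P}^2$ which passes through the three coordinate points $[1:0:0],[0:1:0],[0:0:1]$, such that a line bundle $L$ of degree $-1$ has its modulus $[a_0:a_1:a_\infty]$ in $Z$ if and only if there is a unique smooth point $x\in C$ with $L(x)\simeq\mathcal{O}_C$. The coordinate points are the only points of $Z$ outside $M_O$. -/

import Mathlib

open scoped LinearAlgebra.Projectivization

namespace TripleCurve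

/-- The complex projective line, as the set of lines in `ℂ²`. -/
abbrev P1 : Type := ℙ ℂ (Fin 2 → ℂ)

/-- The value of a polynomial at the chosen representative of a point of the projective line.
Only used for conditions that do not depend on the representative (non-vanishing of a form,
quotients of two forms of the same degree). -/
noncomputable def val (F : MvPolynomial (Fin 2) ℂ) (p : P1) : ℂ := MvPolynomial.eval p.rep F

/-- The Zariski topology of the projective line, generated by the sets `{F ≠ 0}` for forms `F`. -/
@[reducible] def zariski : TopologicalSpace P1 :=
  TopologicalSpace.generateFrom
    {U | ∃ (F : MvPolynomial (Fin 2) ℂ) (n : ℕ), F.IsHomogeneous n ∧ U = {p | val F p ≠ 0}}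

/-- `f` is a regular function on the (open) set `U` of the projective line: near each point of `U`
it is a quotient of two forms of the same degree. -/
def RegularP1 (U : Set P1) (f : P1 → ℂ) : Prop :=
  ∀ p ∈ U, ∃ (n : ℕ) (F G : MvPolynomial (Fin 2) ℂ), F.IsHomogeneous n ∧ G.IsHomogeneous n ∧
    val G p ≠ 0 ∧ ∀ q ∈ U, val G q ≠ 0 → f q = val F q / val G q

/-- The vectors `(0,1)`, `(1,1)`, `(1,0)`. -/
def markedVec : Fin 3 → Fin 2 → ℂ := ![![0, 1], ![1, 1], ![1, 0]]

theorem markedVec_ne_zero (k : Fin 3) : markedVec k ≠ 0 := by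
  fin_cases k
  · intro h
    simpa [markedVec] using congrFun h 1
  · intro h
    simpa [markedVec] using congrFun h 1
  · intro h
    simpa [markedVec] using congrFun h 0

/-- The points `0 = [0:1]`, `1 = [1:1]`, `∞ = [1:0]` of the projective line, where `[u:v]` is the
point with affine coordinate `u / v`. -/
noncomputable def marked (k : Fin 3) : P1 := Projectivization.mk ℂ (markedVec k) (markedVec_ne_zero k)

/-- The equivalence relation on the projective line which identifies `0`, `1` and `∞`. -/
def glue : Setoid P1 where
  r p q := p = q ∨ (p ∈ Set.range marked ∧ q ∈ Set.range marked)
  iseqv :=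
    { refl := fun _ => Or.inl rfl
      symm := by
        rintro p q (h | ⟨h, h'⟩)
        · exact Or.inl h.symm
        · exact Or.inr ⟨h', h⟩
      trans := by
        rintro p q r (rfl | ⟨h, h'⟩) (rfl | ⟨k, k'⟩)
        · exact Or.inl rfl
        · exact Or.inr ⟨k, k'⟩
        · exact Or.inr ⟨h, h'⟩
        · exact Or.inr ⟨h, k'⟩ }

/-- The curve `ℙ¹ / (0, 1, ∞)`. -/
def Curve : Type := Quotient glue

/-- The normalization map `ℙ¹ → ℙ¹ / (0, 1, ∞)`. -/
def proj (p : P1) : Curve := Quotient.mk glue p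

/-- The triple point of the curve, the common image of `0`, `1`, `∞`. -/
noncomputable def triple : Curve := proj (marked 0)

/-- The quotient of the Zariski topology. -/
instance : TopologicalSpace Curve := TopologicalSpace.coinduced proj zariski

/-- The regular functions on an open set of the curve are the functions whose pullback to the
projective line is regular, i.e. the regular functions on the preimage that take equal values at
`0`, `1`, `∞` (if the preimage contains these points). -/
def Regular (U : Set Curve) (f : Curve → ℂ) : Prop := RegularP1 (proj ⁻¹' U) (f ∘ proj)

theorem RegularP1.mul {U V : Set P1} {f g : P1 → ℂ} (hf : RegularP1 U f) (hg : RegularP1 V g) :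
    RegularP1 (U ∩ V) (f * g) := by
  rintro p ⟨hpU, hpV⟩
  obtain ⟨n, F, G, hF, hG, hGp, h⟩ := hf p hpU
  obtain ⟨m, F', G', hF', hG', hGp', h'⟩ := hg p hpV
  refine ⟨n + m, F * F', G * G', hF.mul hF', hG.mul hG', ?_, ?_⟩
  · simpa [val] using ⟨hGp, hGp'⟩
  · rintro q ⟨hqU, hqV⟩ hq
    have hq' : val G q ≠ 0 ∧ val G' q ≠ 0 := by simpa [val] using hq
    have e1 := h q hqU hq'.1
    have e2 := h' q hqV hq'.2
    simp only [val] at e1 e2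
    simp only [Pi.mul_apply, e1, e2, val, map_mul]
    rw [div_mul_div_comm]

theorem Regular.mul {U V : Set Curve} {f g : Curve → ℂ} (hf : Regular U f) (hg : Regular V g) :
    Regular (U ∩ V) (f * g) := RegularP1.mul hf hg

theorem Regular.mono {U V : Set Curve} {f : Curve → ℂ} (hf : Regular U f) (h : V ⊆ U) :
    Regular V f := by
  intro p hp
  obtain ⟨n, F, G, hF, hG, hGp, e⟩ := hf p (h hp)
  exact ⟨n, F, G, hF, hG, hGp, fun q hq => e q (h hq)⟩

theorem regular_one (U : Set Curve) : Regular U 1 := by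
  intro p _
  exact ⟨0, 1, 1, MvPolynomial.isHomogeneous_one _ _, MvPolynomial.isHomogeneous_one _ _,
    by simp [val], fun q _ _ => by simp [val]⟩

/-- An algebraic line bundle on the curve, given by an open covering by trivializing charts and
transition functions `g i j`, which are invertible regular functions on the overlaps and satisfy
the cocycle condition. A section has local coordinates `v i` with `v i = g i j * v j`, and the local
frames satisfy `e j = g i j * e i`. (Values of `g i j` outside the overlap are irrelevant.) -/
structure LineBundle where
  ι : Type
  chart : ι → Set Curve
  isOpen_chart : ∀ i, IsOpen (chart i)
  cover : ∀ c, ∃ i, c ∈ chart i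
  g : ι → ι → Curve → ℂ
  regular_g : ∀ i j, Regular (chart i ∩ chart j) (g i j)
  g_ne_zero : ∀ i j, ∀ c ∈ chart i ∩ chart j, g i j c ≠ 0
  cocycle : ∀ i j k, ∀ c ∈ chart i ∩ chart j ∩ chart k, g i j c * g j k c = g i k c

namespace LineBundle

/-- Isomorphism of line bundles: invertible regular functions `h a i` that express the isomorphism
in the local trivializations `i` of the source and `a` of the target. -/
def Isomorphic (L M : LineBundle) : Prop :=
  ∃ h : M.ι → L.ι → Curve → ℂ,
    (∀ a i, Regular (M.chart a ∩ L.chart i) (h a i)) ∧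
    (∀ a i, ∀ c ∈ M.chart a ∩ L.chart i, h a i c ≠ 0) ∧
    ∀ a b i j, ∀ c ∈ (M.chart a ∩ M.chart b) ∩ (L.chart i ∩ L.chart j),
      M.g a b c * h b j c = h a i c * L.g i j c

/-- The trivial line bundle `𝒪`. -/
def trivial : LineBundle where
  ι := Unit
  chart _ := Set.univ
  isOpen_chart _ := isOpen_univ
  cover _ := ⟨(), Set.mem_univ _⟩
  g _ _ := 1
  regular_g _ _ := regular_one _
  g_ne_zero _ _ _ _ := one_ne_zero
  cocycle _ _ _ _ _ := mul_one _

/-- The tensor product of two line bundles. -/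
def tensor (L M : LineBundle) : LineBundle where
  ι := L.ι × M.ι
  chart i := L.chart i.1 ∩ M.chart i.2
  isOpen_chart i := (L.isOpen_chart i.1).inter (M.isOpen_chart i.2)
  cover c := by
    obtain ⟨i, hi⟩ := L.cover c
    obtain ⟨a, ha⟩ := M.cover c
    exact ⟨(i, a), hi, ha⟩
  g i j := L.g i.1 j.1 * M.g i.2 j.2
  regular_g i j := ((L.regular_g i.1 j.1).mul (M.regular_g i.2 j.2)).mono
    fun _ hc => ⟨⟨hc.1.1, hc.2.1⟩, ⟨hc.1.2, hc.2.2⟩⟩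
  g_ne_zero i j c hc := mul_ne_zero (L.g_ne_zero i.1 j.1 c ⟨hc.1.1, hc.2.1⟩)
    (M.g_ne_zero i.2 j.2 c ⟨hc.1.2, hc.2.2⟩)
  cocycle i j k c hc := by
    have h1 := L.cocycle i.1 j.1 k.1 c ⟨⟨hc.1.1.1, hc.1.2.1⟩, hc.2.1⟩
    have h2 := M.cocycle i.2 j.2 k.2 c ⟨⟨hc.1.1.2, hc.1.2.2⟩, hc.2.2⟩
    simp only [Pi.mul_apply]
    rw [← h1, ← h2]
    ring

end LineBundle

/-- A linear form on `ℂ²` whose only zero on the projective line is `p` (a simple zero). -/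
noncomputable def linForm (p : P1) : MvPolynomial (Fin 2) ℂ :=
  MvPolynomial.C (p.rep 1) * MvPolynomial.X 0 - MvPolynomial.C (p.rep 0) * MvPolynomial.X 1

theorem linForm_isHomogeneous (p : P1) : (linForm p).IsHomogeneous 1 := by
  have h : ∀ (a : ℂ) (i : Fin 2),
      (MvPolynomial.C a * MvPolynomial.X i : MvPolynomial (Fin 2) ℂ).IsHomogeneous 1 := by
    intro a i
    simpa using (MvPolynomial.isHomogeneous_C (Fin 2) a).mul (MvPolynomial.isHomogeneous_X ℂ i)
  exact (h _ _).sub (h _ _)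

theorem val_linForm (p q : P1) : val (linForm p) q = p.rep 1 * q.rep 0 - p.rep 0 * q.rep 1 := by
  simp [val, linForm]

theorem val_linForm_eq_zero_iff (p q : P1) : val (linForm p) q = 0 ↔ q = p := by
  rw [val_linForm]
  constructor
  · intro h
    rw [← p.mk_rep, ← q.mk_rep, Projectivization.mk_eq_mk_iff']
    have hp : p.rep 0 ≠ 0 ∨ p.rep 1 ≠ 0 := by
      by_contra! hh
      exact p.rep_nonzero (by ext i; fin_cases i <;> simp [hh])
    rcases hp with hp | hp
    · refine ⟨q.rep 0 / p.rep 0, ?_⟩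
      ext i
      fin_cases i
      · simp [hp]
      · simp only [Pi.smul_apply, smul_eq_mul, Fin.mk_one]
        field_simp
        linear_combination h
    · refine ⟨q.rep 1 / p.rep 1, ?_⟩
      ext i
      fin_cases i
      · simp only [Pi.smul_apply, smul_eq_mul, Fin.zero_eta]
        field_simp
        linear_combination -h
      · simp [hp]
  · rintro rfl
    ring

theorem isOpen_compl_singleton_P1 (p : P1) : @IsOpen _ zariski ({p}ᶜ : Set P1) := by
  refine TopologicalSpace.isOpen_generateFrom_of_mem ⟨linForm p, 1, linForm_isHomogeneous p, ?_⟩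
  ext q
  simp [val_linForm_eq_zero_iff]

theorem proj_eq_proj_iff (p q : P1) :
    proj p = proj q ↔ p = q ∨ (p ∈ Set.range marked ∧ q ∈ Set.range marked) := by
  constructor
  · intro h
    exact Quotient.exact h
  · intro h
    exact Quotient.sound h

theorem proj_eq_triple_iff (p : P1) : proj p = triple ↔ p ∈ Set.range marked := by
  rw [triple, proj_eq_proj_iff]
  constructor
  · rintro (rfl | h)
    · exact ⟨0, rfl⟩
    · exact h.1
  · intro h
    exact Or.inr ⟨h, 0, rfl⟩

theorem isOpen_compl_triple : IsOpen ({triple}ᶜ : Set Curve) := by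
  refine isOpen_coinduced.2 ?_
  have : proj ⁻¹' ({triple}ᶜ : Set Curve)
      = {marked 0}ᶜ ∩ ({marked 1}ᶜ ∩ {marked 2}ᶜ) := by
    ext p
    simp only [Set.mem_preimage, Set.mem_compl_iff, Set.mem_singleton_iff, proj_eq_triple_iff,
      Set.mem_range, Set.mem_inter_iff, not_exists, Fin.forall_fin_succ]
    simp [eq_comm]
  rw [this]
  let _ := zariski
  exact (isOpen_compl_singleton_P1 _).inter
    ((isOpen_compl_singleton_P1 _).inter (isOpen_compl_singleton_P1 _))

theorem isOpen_compl_proj {p : P1} (hp : proj p ≠ triple) : IsOpen ({proj p}ᶜ : Set Curve) := by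
  refine isOpen_coinduced.2 ?_
  have : proj ⁻¹' ({proj p}ᶜ : Set Curve) = {p}ᶜ := by
    ext q
    simp only [Set.mem_preimage, Set.mem_compl_iff, Set.mem_singleton_iff, proj_eq_proj_iff]
    rw [Ne, proj_eq_triple_iff] at hp
    tauto
  rw [this]
  exact isOpen_compl_singleton_P1 p

/-- The preimage in the projective line of a point of the curve (unique unless the point is the
triple point). -/
noncomputable def lift (c : Curve) : P1 := Quotient.out c

theorem proj_lift (c : Curve) : proj (lift c) = c := Quotient.out_eq c

theorem lift_proj {p : P1} (hp : proj p ≠ triple) : lift (proj p) = p := by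
  have h := (proj_eq_proj_iff _ _).1 (proj_lift (proj p))
  rw [Ne, proj_eq_triple_iff] at hp
  tauto

/-- The affine coordinate `u / v` of the point `[u:v]`, as a function on the curve without the
triple point. -/
noncomputable def coord (c : Curve) : ℂ := (lift c).rep 0 / (lift c).rep 1

theorem rep_one_ne_zero {p : P1} (hp : proj p ≠ triple) : p.rep 1 ≠ 0 := by
  intro h
  apply hp
  rw [proj_eq_triple_iff]
  refine ⟨2, ?_⟩
  rw [marked, ← p.mk_rep, Projectivization.mk_eq_mk_iff']
  have h0 : p.rep 0 ≠ 0 := fun h0 => p.rep_nonzero (by ext i; fin_cases i <;> simp [h, h0])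
  refine ⟨(p.rep 0)⁻¹, ?_⟩
  ext i
  fin_cases i
  · simp [markedVec, h0]
  · simp [markedVec, h]

theorem coord_sub_eq {p : P1} (hp : proj p ≠ triple) {x : Curve} (hx : x ≠ triple) :
    coord (proj p) - coord x
      = val (linForm (lift x)) p / val (MvPolynomial.C ((lift x).rep 1) * MvPolynomial.X 1) p := by
  have h1 := rep_one_ne_zero hp
  have h2 : (lift x).rep 1 ≠ 0 := rep_one_ne_zero (by rwa [proj_lift])
  rw [val_linForm, coord, coord, lift_proj hp]
  simp only [val, map_mul, MvPolynomial.eval_C, MvPolynomial.eval_X]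
  field_simp

theorem isHomogeneous_den (a : ℂ) :
    (MvPolynomial.C a * MvPolynomial.X 1 : MvPolynomial (Fin 2) ℂ).IsHomogeneous 1 := by
  simpa using (MvPolynomial.isHomogeneous_C (Fin 2) a).mul (MvPolynomial.isHomogeneous_X ℂ 1)

theorem val_den_ne_zero {p : P1} (hp : proj p ≠ triple) {x : Curve} (hx : x ≠ triple) :
    val (MvPolynomial.C ((lift x).rep 1) * MvPolynomial.X 1) p ≠ 0 := by
  have h1 := rep_one_ne_zero hp
  have h2 : (lift x).rep 1 ≠ 0 := rep_one_ne_zero (by rwa [proj_lift])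
  simpa [val] using ⟨h2, h1⟩

theorem coord_sub_ne_zero {c x : Curve} (hc : c ≠ triple) (hx : x ≠ triple) (h : c ≠ x) :
    coord c - coord x ≠ 0 := by
  obtain ⟨p, rfl⟩ : ∃ p, proj p = c := ⟨_, proj_lift c⟩
  rw [coord_sub_eq hc hx]
  refine div_ne_zero ?_ (val_den_ne_zero hc hx)
  rw [Ne, val_linForm_eq_zero_iff]
  rintro rfl
  exact h (proj_lift x)

theorem regular_coord_sub {x : Curve} (hx : x ≠ triple) {U : Set Curve} (hU : triple ∉ U) :
    Regular U (fun c => coord c - coord x) := by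
  intro p hp
  have hne : ∀ q ∈ proj ⁻¹' U, proj q ≠ triple := fun q hq h => hU (h ▸ hq)
  exact ⟨1, _, _, linForm_isHomogeneous (lift x), isHomogeneous_den _,
    val_den_ne_zero (hne p hp) hx, fun q hq _ => coord_sub_eq (hne q hq) hx⟩

theorem regular_coord_sub_inv {x : Curve} (hx : x ≠ triple) {U : Set Curve} (hU : triple ∉ U)
    (hxU : x ∉ U) : Regular U (fun c => (coord c - coord x)⁻¹) := by
  intro p hp
  have hne : ∀ q ∈ proj ⁻¹' U, proj q ≠ triple := fun q hq h => hU (h ▸ hq)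
  refine ⟨1, _, _, isHomogeneous_den ((lift x).rep 1), linForm_isHomogeneous (lift x), ?_, fun q hq _ => ?_⟩
  · rw [Ne, val_linForm_eq_zero_iff]
    rintro rfl
    rw [Set.mem_preimage, proj_lift] at hp
    exact hxU hp
  · simp only [Function.comp_apply, coord_sub_eq (hne q hq) hx, inv_div]

/-- The charts of `𝒪(x)`: the complement of `x` (with frame `1`) and the complement of the triple
point (with frame `1 / (t - x)`, where `t` is the affine coordinate). -/
def pointChart (x : Curve) : Bool → Set Curve
  | false => {x}ᶜ
  | true => {triple}ᶜ

/-- The transition functions of `𝒪(x)`. -/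
noncomputable def pointG (x : Curve) : Bool → Bool → Curve → ℂ
  | false, false => 1
  | true, true => 1
  | true, false => fun c => coord c - coord x
  | false, true => fun c => (coord c - coord x)⁻¹

/-- The line bundle `𝒪(x)`, for a smooth point `x` of the curve. -/
noncomputable def pointBundle (x : {c : Curve // c ≠ triple}) : LineBundle where
  ι := Bool
  chart := pointChart x
  isOpen_chart := by
    rintro (_ | _)
    · have h := isOpen_compl_proj (p := lift x.1) (by rw [proj_lift]; exact x.2)
      rwa [proj_lift] at h
    · exact isOpen_compl_triple
  cover c := by
    by_cases h : c = x.1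
    · exact ⟨true, by rw [h]; exact x.2⟩
    · exact ⟨false, h⟩
  g := pointG x
  regular_g := by
    rintro (_ | _) (_ | _)
    · exact regular_one _
    · exact regular_coord_sub_inv x.2 (fun h => h.2 rfl) (fun h => h.1 rfl)
    · exact regular_coord_sub x.2 (fun h => h.1 rfl)
    · exact regular_one _
  g_ne_zero := by
    rintro (_ | _) (_ | _) c hc
    · exact one_ne_zero
    · exact inv_ne_zero (coord_sub_ne_zero hc.2 x.2 hc.1)
    · exact coord_sub_ne_zero hc.1 x.2 hc.2
    · exact one_ne_zero
  cocycle := by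
    have key : ∀ c : Curve, c ∈ ({triple}ᶜ : Set Curve) → c ∈ ({x.1}ᶜ : Set Curve) →
        coord c - coord x.1 ≠ 0 := fun c h1 h2 => coord_sub_ne_zero h1 x.2 h2
    rintro (_ | _) (_ | _) (_ | _) c ⟨⟨h1, h2⟩, h3⟩ <;> simp only [pointChart] at h1 h2 h3 <;>
      simp only [pointG, Pi.one_apply, one_mul, mul_one]
    · exact inv_mul_cancel₀ (key c h2 h1)
    · exact mul_inv_cancel₀ (key c h1 h2)

/-- The order of vanishing of a nonzero form on `ℂ²` at a point of the projective line. -/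
noncomputable def ord (p : P1) (F : MvPolynomial (Fin 2) ℂ) : ℕ := multiplicity (linForm p) F

namespace LineBundle

/-- The twist `L(x) = L ⊗ 𝒪(x)` of a line bundle by a smooth point `x` of the curve. -/
noncomputable def twist (L : LineBundle) (x : {c : Curve // c ≠ triple}) : LineBundle :=
  L.tensor (pointBundle x)

/-- `L` has degree (Chern number) `d`: the pullback of `L` to the projective line has a nonzero
rational section, with local coordinates `F i / G i` (quotients of forms of the same degree), whose
divisor `D` has degree `d`. -/
def HasDegree (L : LineBundle) (d : ℤ) : Prop :=
  ∃ (n : L.ι → ℕ) (F G : L.ι → MvPolynomial (Fin 2) ℂ) (D : P1 →₀ ℤ),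
    (∀ i, (F i).IsHomogeneous (n i) ∧ (G i).IsHomogeneous (n i) ∧ F i ≠ 0 ∧ G i ≠ 0) ∧
    (∀ i j p, proj p ∈ L.chart i ∩ L.chart j →
      val (F i) p * val (G j) p = L.g i j (proj p) * (val (F j) p * val (G i) p)) ∧
    (∀ i p, proj p ∈ L.chart i → D p = (ord p (F i) : ℤ) - (ord p (G i) : ℤ)) ∧
    (D.sum fun _ m => m) = d

/-- `s` is an isomorphism from the pullback of `L` to the projective line onto the tautological
line bundle `𝒪(-1)`, the subbundle of the trivial bundle with fibre `ℂ²` whose fibre at `p` is the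
line `p`. The isomorphism is given by the images `s i` of the local frames of `L`. -/
def IsTautIso (L : LineBundle) (s : L.ι → P1 → Fin 2 → ℂ) : Prop :=
  (∀ i p, proj p ∈ L.chart i → s i p ∈ p.submodule ∧ s i p ≠ 0) ∧
  (∀ i l, RegularP1 (proj ⁻¹' L.chart i) (fun p => s i p l)) ∧
  ∀ i j p, proj p ∈ L.chart i ∩ L.chart j → s j p = L.g i j (proj p) • s i p

/-- Let `b k` be basis vectors of the fibres of `𝒪(-1)` at `0`, `1`, `∞`. The point
`P = [a 0 : a 1 : a 2]` of the projective plane is the modulus of `L` if under some isomorphism of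
the pullback of `L` with `𝒪(-1)` some nonzero vector of the fibre of `L` at the triple point (the
vector of a local frame) is sent to the vectors `a k • b k` in the fibres at `0`, `1`, `∞`. -/
def IsModulus (b : Fin 3 → Fin 2 → ℂ) (L : LineBundle) (P : ℙ ℂ (Fin 3 → ℂ)) : Prop :=
  ∃ s : L.ι → P1 → Fin 2 → ℂ, L.IsTautIso s ∧
    ∃ i, triple ∈ L.chart i ∧ ∃ (a : Fin 3 → ℂ) (ha : a ≠ 0),
      (∀ k, s i (marked k) = a k • b k) ∧ P = Projectivization.mk ℂ a ha

end LineBundle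

/-- The zero locus in the projective plane of a form in three variables. -/
def zeroLocus (Q : MvPolynomial (Fin 3) ℂ) : Set (ℙ ℂ (Fin 3 → ℂ)) :=
  {P | MvPolynomial.eval P.rep Q = 0}

/-- The points `[1:0:0]`, `[0:1:0]`, `[0:0:1]` of the projective plane. -/
noncomputable def coordPoint (k : Fin 3) : ℙ ℂ (Fin 3 → ℂ) :=
  Projectivization.mk ℂ (Pi.single k 1) (Pi.single_ne_zero_iff.2 one_ne_zero)

end TripleCurve

namespace TripleCurve

open MvPolynomial

/-! A bundle of degree -1 pulls back to 𝒪(-1), and two isomorphisms of the pullback with 𝒪(-1)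
differ by a constant, because regular functions on ℙ¹ are constant (`RegularP1.eq_of_univ`). What
remains of the bundle is the way the fibres at 0, 1, ∞ are identified: three nonzero numbers up to a
common factor.

Such an isomorphism is encoded by `TautCoef`, a family `lam i` of nowhere vanishing fractions of
forms of degree -1. It exists by comparing divisors (`HasDegree.exists_tautCoef`) and is unique up
to a constant (`TautCoef.exists_eq_mul`). If two families are proportional at the marked points,
their quotients descend to the curve and give an isomorphism (`TautCoef.isomorphic`). Every triple
of nonzero values occurs, by interpolation with forms (`exists_lineBundle`).

The twist L(x) is trivial exactly when the inverse of the linear form ℓ vanishing at x serves as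
trivialization, that is, when `lam i` times ℓ has the same value at the three marked points
(`TautCoef.twist_isomorphic_iff`). Let u₀, u₁, u₂ be the modulus expressed in the basis vectors
(0,1), (1,1), (1,0). The condition is that u₀ℓ(0,1), u₁ℓ(1,1), u₂ℓ(1,0) are one nonzero constant.
Since (1,1) = (0,1) + (1,0), such an ℓ exists if and only if 1/u₁ = 1/u₀ + 1/u₂, which is the conic
u₀u₂ = u₁u₂ + u₀u₁ (`exists_point_iff`). The values at two basis vectors determine ℓ, so x is unique
(`point_unique`). -/

theorem rep_zero_ne_zero_or (p : P1) : p.rep 0 ≠ 0 ∨ p.rep 1 ≠ 0 := by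
  by_contra! hh
  exact p.rep_nonzero (by ext i; fin_cases i <;> simp [hh])

/-! ### Forms in two variables: zeros, orders, and the Zariski topology -/

/-- Restriction of polynomials to the line `p`, parametrized by `p.rep`. -/
noncomputable def restrictLine (p : P1) : MvPolynomial (Fin 2) ℂ →ₐ[ℂ] Polynomial ℂ :=
  aeval fun i => Polynomial.C (p.rep i) * Polynomial.X

/-- Modulo `linForm p` each variable is a multiple of `X k`, where `p.rep k ≠ 0`. Hence the quotient
map factors through the restriction to the line, and the kernel of the restriction is generated by
`linForm p`. -/
theorem linForm_dvd_iff_restrictLine (p : P1) (F : MvPolynomial (Fin 2) ℂ) :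
    linForm p ∣ F ↔ restrictLine p F = 0 := by
  constructor
  · rintro ⟨G, rfl⟩
    rw [map_mul]
    convert zero_mul _
    simp [restrictLine, linForm, algHom_C]
    ring
  · intro h
    obtain ⟨k, hk⟩ : ∃ k, p.rep k ≠ 0 := by
      rcases rep_zero_ne_zero_or p with h | h <;> exact ⟨_, h⟩
    let ψ : Polynomial ℂ →ₐ[ℂ] MvPolynomial (Fin 2) ℂ := Polynomial.aeval (C (p.rep k)⁻¹ * X k)
    let I : Ideal (MvPolynomial (Fin 2) ℂ) := Ideal.span {linForm p}
    have key : ((Ideal.Quotient.mkₐ ℂ I).comp ψ).comp (restrictLine p) = Ideal.Quotient.mkₐ ℂ I := by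
      ext j
      simp only [AlgHom.comp_apply, restrictLine, aeval_X, map_mul, ψ, Polynomial.aeval_C,
        Polynomial.aeval_X, Ideal.Quotient.mkₐ_eq_mk]
      rw [← map_mul, ← map_mul, Ideal.Quotient.eq, Ideal.mem_span_singleton, linForm,
        MvPolynomial.algebraMap_eq]
      have hC : (C (p.rep k)⁻¹ * C (p.rep k) : MvPolynomial (Fin 2) ℂ) = 1 := by
        rw [← C_mul, inv_mul_cancel₀ hk, C_1]
      fin_cases k <;> fin_cases j <;> simp only [Fin.zero_eta, Fin.mk_one] at hC ⊢
      · exact ⟨0, by linear_combination X 0 * hC⟩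
      · exact ⟨C (p.rep 0)⁻¹, by linear_combination X 1 * hC⟩
      · exact ⟨- C (p.rep 1)⁻¹, by linear_combination X 0 * hC⟩
      · exact ⟨0, by linear_combination X 1 * hC⟩
    have h2 := DFunLike.congr_fun key F
    rw [AlgHom.comp_apply, h, map_zero, eq_comm, Ideal.Quotient.mkₐ_eq_mk,
      Ideal.Quotient.eq_zero_iff_mem, Ideal.mem_span_singleton] at h2
    exact h2

theorem restrictLine_of_isHomogeneous (p : P1) {F : MvPolynomial (Fin 2) ℂ} {n : ℕ}
    (hF : F.IsHomogeneous n) : restrictLine p F = Polynomial.C (val F p) * Polynomial.X ^ n := by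
  rw [restrictLine, aeval_def, eval₂_eq', val, eval_eq', map_sum, Finset.sum_mul]
  refine Finset.sum_congr rfl fun d hd => ?_
  have hdeg : ∑ i, d i = n := by
    rw [← Finsupp.degree_eq_sum]; exact (hF.degree_eq_sum_deg_support hd).symm
  simp only [mul_pow, Finset.prod_mul_distrib, Finset.prod_pow_eq_pow_sum, hdeg, map_mul, map_prod,
    map_pow, Polynomial.algebraMap_eq]
  ring

theorem linForm_dvd_iff (p : P1) {F : MvPolynomial (Fin 2) ℂ} {n : ℕ} (hF : F.IsHomogeneous n) :
    linForm p ∣ F ↔ val F p = 0 := by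
  rw [linForm_dvd_iff_restrictLine, restrictLine_of_isHomogeneous p hF]
  simp

theorem linForm_ne_zero (p : P1) : linForm p ≠ 0 := by
  intro h
  have h0 := congrArg (eval ![1, 0]) h
  have h1 := congrArg (eval ![0, 1]) h
  simp [linForm] at h0 h1
  rcases rep_zero_ne_zero_or p with h | h <;> simp_all

/-- `linForm p` generates the kernel of a homomorphism to a domain. -/
theorem prime_linForm (p : P1) : Prime (linForm p) := by
  refine ⟨linForm_ne_zero p, fun h => ?_, fun F G h => ?_⟩
  · have := (linForm_dvd_iff_restrictLine p 1).1 h.dvd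
    simp at this
  · simp only [linForm_dvd_iff_restrictLine, map_mul, mul_eq_zero] at h ⊢
    exact h

theorem finiteMultiplicity_linForm (p : P1) {F : MvPolynomial (Fin 2) ℂ} (hF : F ≠ 0) :
    FiniteMultiplicity (linForm p) F :=
  FiniteMultiplicity.of_prime_left (prime_linForm p) hF

theorem ord_mul (p : P1) {F G : MvPolynomial (Fin 2) ℂ} (hF : F ≠ 0) (hG : G ≠ 0) :
    ord p (F * G) = ord p F + ord p G :=
  multiplicity_mul (prime_linForm p) (finiteMultiplicity_linForm p (mul_ne_zero hF hG))

theorem ord_eq_zero {p : P1} {F : MvPolynomial (Fin 2) ℂ} {n : ℕ} (hF : F.IsHomogeneous n)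
    (h : val F p ≠ 0) : ord p F = 0 :=
  multiplicity_eq_zero.2 ((linForm_dvd_iff p hF).not.2 h)

theorem ord_linForm_self (p : P1) : ord p (linForm p) = 1 := multiplicity_self

/-- The component of `A * U` in degree `N` is `A` times the component of `U` in degree `N - m`;
cancelling `A` shows that `U` equals that component. -/
theorem isHomogeneous_of_mul {A U : MvPolynomial (Fin 2) ℂ} {m N : ℕ} (hA : A.IsHomogeneous m)
    (hA0 : A ≠ 0) (hN : (A * U).IsHomogeneous N) (hU : U ≠ 0) :
    ∃ n, m + n = N ∧ U.IsHomogeneous n := by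
  classical
  let _ : GradedAlgebra (homogeneousSubmodule (Fin 2) ℂ) := MvPolynomial.gradedAlgebra
  have hmem : A ∈ homogeneousSubmodule (Fin 2) ℂ m := hA
  have hself : (DirectSum.decompose (homogeneousSubmodule (Fin 2) ℂ) (A * U) N :
      MvPolynomial (Fin 2) ℂ) = A * U :=
    DirectSum.decompose_of_mem_same (homogeneousSubmodule (Fin 2) ℂ)
      ((mem_homogeneousSubmodule N (A * U)).2 hN)
  by_cases hmn : m ≤ N
  · refine ⟨N - m, by omega, ?_⟩
    rw [DirectSum.coe_decompose_mul_of_left_mem_of_le _ hmem hmn] at hself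
    rw [← mul_left_cancel₀ hA0 hself]
    exact (DirectSum.decompose (homogeneousSubmodule (Fin 2) ℂ) U (N - m)).2
  · rw [DirectSum.coe_decompose_mul_of_left_mem_of_not_le _ hmem hmn] at hself
    exact absurd hself.symm (mul_ne_zero hA0 hU)

theorem eval_smul_eq {F : MvPolynomial (Fin 2) ℂ} {n : ℕ} (hF : F.IsHomogeneous n)
    (c : ℂ) (v : Fin 2 → ℂ) : eval (c • v) F = c ^ n * eval v F := by
  rw [eval_eq', eval_eq', Finset.mul_sum]
  refine Finset.sum_congr rfl fun d hd => ?_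
  have hdeg : ∑ i, d i = n := by
    rw [← Finsupp.degree_eq_sum]; exact (hF.degree_eq_sum_deg_support hd).symm
  simp only [Pi.smul_apply, smul_eq_mul, mul_pow, Finset.prod_mul_distrib,
    Finset.prod_pow_eq_pow_sum, hdeg]
  ring

theorem exists_smul_rep {v : Fin 2 → ℂ} (hv : v ≠ 0) :
    ∃ c : ℂ, c ≠ 0 ∧ v = c • (Projectivization.mk ℂ v hv : P1).rep := by
  obtain ⟨a, ha⟩ := Projectivization.exists_smul_eq_mk_rep ℂ v hv
  refine ⟨(a⁻¹ : ℂˣ), Units.ne_zero _, ?_⟩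
  rw [← ha, ← Units.smul_def, inv_smul_smul]

theorem val_mk_eq_zero_iff {F : MvPolynomial (Fin 2) ℂ} {n : ℕ} (hF : F.IsHomogeneous n)
    {v : Fin 2 → ℂ} (hv : v ≠ 0) : val F (Projectivization.mk ℂ v hv) = 0 ↔ eval v F = 0 := by
  obtain ⟨c, hc, h⟩ := exists_smul_rep hv
  have h2 := eval_smul_eq hF c (Projectivization.mk ℂ v hv : P1).rep
  rw [← h] at h2
  rw [h2, val]
  simp [hc]

theorem form_eq_zero {F B : MvPolynomial (Fin 2) ℂ} {n m : ℕ} (hF : F.IsHomogeneous n)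
    (hB : B.IsHomogeneous m) (hB0 : B ≠ 0) (h : ∀ q, val B q ≠ 0 → val F q = 0) : F = 0 := by
  -- The factor `X 0` takes care of the zero vector, which represents no point of the projective
  -- line.
  have h0 : F * (B * X 0) = 0 := by
    refine MvPolynomial.funext fun v => ?_
    by_cases hv : v = 0
    · simp [hv]
    · have hz := h (Projectivization.mk ℂ v hv)
      rw [Ne, val_mk_eq_zero_iff hB, val_mk_eq_zero_iff hF] at hz
      by_cases hBv : eval v B = 0
      · simp [hBv]
      · simp [hz hBv]
  rcases mul_eq_zero.1 h0 with h1 | h1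
  · exact h1
  · exact absurd h1 (mul_ne_zero hB0 (X_ne_zero 0))

theorem exists_val_eq_zero {F : MvPolynomial (Fin 2) ℂ} {n : ℕ} (hF : F.IsHomogeneous n)
    (hn : n ≠ 0) : ∃ p, val F p = 0 := by
  suffices ∃ v : Fin 2 → ℂ, v ≠ 0 ∧ eval v F = 0 by
    obtain ⟨v, hv, h⟩ := this
    exact ⟨_, (val_mk_eq_zero_iff hF hv).2 h⟩
  let f : Polynomial ℂ := aeval ![Polynomial.X, 1] F
  let g : Polynomial ℂ := aeval ![1, Polynomial.X] F
  have hf : ∀ t, f.eval t = eval ![t, 1] F := by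
    intro t
    rw [← Polynomial.coe_aeval_eq_eval, ← AlgHom.comp_apply, comp_aeval, ← aeval_eq_eval]
    congr 2
    ext i; fin_cases i <;> simp
  have hg : ∀ t, g.eval t = eval ![1, t] F := by
    intro t
    rw [← Polynomial.coe_aeval_eq_eval, ← AlgHom.comp_apply, comp_aeval, ← aeval_eq_eval]
    congr 2
    ext i; fin_cases i <;> simp
  by_cases hdeg : f.degree = 0
  · obtain ⟨c, hc⟩ : ∃ c, f = Polynomial.C c := ⟨_, Polynomial.eq_C_of_degree_eq_zero hdeg⟩
    -- Here `g(t) = t ^ n f(1/t)`, so a constant `f` forces `g = c t ^ n`, and `F` vanishes at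
    -- `[1:0]`. The other case includes `f = 0`, whose degree is `⊥`.
    have hgc : g = Polynomial.C c * Polynomial.X ^ n := by
      refine Polynomial.eq_of_infinite_eval_eq _ _ (Set.Infinite.mono (s := {0}ᶜ) ?_ ?_)
      · intro t ht
        have h1 := hf t⁻¹
        rw [hc, Polynomial.eval_C] at h1
        have hne : (![t⁻¹, 1] : Fin 2 → ℂ) ≠ 0 := fun h => by simpa using congrFun h 1
        have hv : t • (![t⁻¹, 1] : Fin 2 → ℂ) = ![1, t] := by
          ext i; fin_cases i
          · simpa using mul_inv_cancel₀ ht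
          · simp
        rw [Set.mem_ofPred_eq, hg, ← hv, eval_smul_eq hF, ← h1, Polynomial.eval_mul, Polynomial.eval_C,
          Polynomial.eval_pow, Polynomial.eval_X, mul_comm]
      · exact (Set.finite_singleton (0 : ℂ)).infinite_compl
    refine ⟨![1, 0], fun h => by simpa using congrFun h 0, ?_⟩
    rw [← hg, hgc]
    simp [hn]
  · obtain ⟨t, ht⟩ := IsAlgClosed.exists_root f hdeg
    exact ⟨![t, 1], fun h => by simpa using congrFun h 1, by rw [← hf]; exact ht⟩

/-- The sets `{F ≠ 0}` are closed under finite intersection by multiplying forms, so this generating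
family is already a basis. -/
theorem exists_form_of_isOpen {W : Set P1} (hW : @IsOpen _ zariski W) {p : P1} (hp : p ∈ W) :
    ∃ (n : ℕ) (B : MvPolynomial (Fin 2) ℂ), B.IsHomogeneous n ∧ val B p ≠ 0 ∧
      ∀ q, val B q ≠ 0 → q ∈ W := by
  induction hW with
  | basic s hs =>
    obtain ⟨F, n, hF, rfl⟩ := hs
    exact ⟨n, F, hF, hp, fun q hq => hq⟩
  | univ => exact ⟨0, 1, isHomogeneous_one _ _, by simp [val], fun _ _ => trivial⟩
  | inter s t _ _ hs ht =>
    obtain ⟨n, B, hB, hBp, h⟩ := hs hp.1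
    obtain ⟨m, B', hB', hBp', h'⟩ := ht hp.2
    refine ⟨n + m, B * B', hB.mul hB', by simpa [val] using ⟨hBp, hBp'⟩, fun q hq => ?_⟩
    have hq' : val B q ≠ 0 ∧ val B' q ≠ 0 := by simpa [val] using hq
    exact ⟨h q hq'.1, h' q hq'.2⟩
  | sUnion S _ ih =>
    obtain ⟨s, hs, hps⟩ := hp
    obtain ⟨n, B, hB, hBp, h⟩ := ih s hs hps
    exact ⟨n, B, hB, hBp, fun q hq => ⟨s, hs, h q hq⟩⟩

/-! ### Regular sections of 𝒪(d), and constancy of global functions -/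

/-- Near each point of `U`, the function `f` on chosen representatives is a quotient of two forms
whose degrees differ by `d`. For `d = 0` these are the regular functions, and in general the
regular sections of `𝒪(d)`. -/
def RegDeg (d : ℤ) (U : Set P1) (f : P1 → ℂ) : Prop :=
  ∀ p ∈ U, ∃ (m n : ℕ) (F G : MvPolynomial (Fin 2) ℂ), F.IsHomogeneous m ∧ G.IsHomogeneous n ∧
    (m : ℤ) = n + d ∧ val G p ≠ 0 ∧ ∀ q ∈ U, val G q ≠ 0 → f q = val F q / val G q

theorem val_mul (F G : MvPolynomial (Fin 2) ℂ) (p : P1) : val (F * G) p = val F p * val G p := by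
  simp [val]

theorem regDeg_zero_iff {U : Set P1} {f : P1 → ℂ} : RegDeg 0 U f ↔ RegularP1 U f := by
  constructor
  · intro h p hp
    obtain ⟨m, n, F, G, hF, hG, hmn, h1, h2⟩ := h p hp
    obtain rfl : m = n := by omega
    exact ⟨m, F, G, hF, hG, h1, h2⟩
  · intro h p hp
    obtain ⟨m, F, G, hF, hG, h1, h2⟩ := h p hp
    exact ⟨m, m, F, G, hF, hG, by simp, h1, h2⟩

theorem regDeg_val {F : MvPolynomial (Fin 2) ℂ} {n : ℕ} (hF : F.IsHomogeneous n) (U : Set P1) :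
    RegDeg n U (val F) := fun p _ =>
  ⟨n, 0, F, 1, hF, isHomogeneous_one _ _, by simp, by simp [val], fun q _ _ => by simp [val]⟩

namespace RegDeg

variable {d e : ℤ} {U V : Set P1} {f g : P1 → ℂ}

theorem mono (hf : RegDeg d U f) (h : V ⊆ U) : RegDeg d V f := by
  intro p hp
  obtain ⟨m, n, F, G, hF, hG, hmn, hGp, e⟩ := hf p (h hp)
  exact ⟨m, n, F, G, hF, hG, hmn, hGp, fun q hq => e q (h hq)⟩

theorem congr (hf : RegDeg d U f) (h : ∀ p ∈ U, g p = f p) : RegDeg d U g := by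
  intro p hp
  obtain ⟨m, n, F, G, hF, hG, hmn, hGp, e⟩ := hf p hp
  exact ⟨m, n, F, G, hF, hG, hmn, hGp, fun q hq hGq => (h q hq).trans (e q hq hGq)⟩

theorem mul (hf : RegDeg d U f) (hg : RegDeg e U g) : RegDeg (d + e) U (fun p => f p * g p) := by
  intro p hp
  obtain ⟨m, n, F, G, hF, hG, hmn, hGp, h⟩ := hf p hp
  obtain ⟨m', n', F', G', hF', hG', hmn', hGp', h'⟩ := hg p hp
  refine ⟨m + m', n + n', F * F', G * G', hF.mul hF', hG.mul hG', by push_cast; omega, ?_, ?_⟩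
  · rw [val_mul]; exact mul_ne_zero hGp hGp'
  · intro q hq hGq
    rw [val_mul] at hGq
    dsimp only
    rw [val_mul, val_mul, h q hq (left_ne_zero_of_mul hGq), h' q hq (right_ne_zero_of_mul hGq),
      div_mul_div_comm]

theorem inv (hf : RegDeg d U f) (h0 : ∀ p ∈ U, f p ≠ 0) : RegDeg (-d) U (fun p => (f p)⁻¹) := by
  intro p hp
  obtain ⟨m, n, F, G, hF, hG, hmn, hGp, h⟩ := hf p hp
  -- The extra factor `G` keeps the denominator zero wherever the formula for `f` is unavailable.
  refine ⟨n + n, m + n, G * G, F * G, hG.mul hG, hF.mul hG, by push_cast; omega, ?_, ?_⟩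
  · rw [val_mul]
    refine mul_ne_zero (fun hFp => h0 p hp ?_) hGp
    rw [h p hp hGp, hFp, zero_div]
  · intro q hq hGq
    rw [val_mul] at hGq
    have hGq' := right_ne_zero_of_mul hGq
    dsimp only
    rw [val_mul, val_mul, h q hq hGq', inv_div, mul_div_mul_right _ _ hGq']

theorem div (hf : RegDeg d U f) (hg : RegDeg e U g) (h0 : ∀ p ∈ U, g p ≠ 0) :
    RegDeg (d - e) U (fun p => f p / g p) := by
  simpa only [div_eq_mul_inv, sub_eq_add_neg] using hf.mul (hg.inv h0)

/-- Numerator and denominator are multiplied by a form `B` with `{B ≠ 0} ⊆ W`, which makes the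
fraction valid wherever the new denominator is nonzero on `U`. -/
theorem of_locally (h : ∀ p ∈ U, ∃ W, @IsOpen _ zariski W ∧ p ∈ W ∧ RegDeg d (U ∩ W) f) :
    RegDeg d U f := by
  intro p hp
  obtain ⟨W, hW, hpW, hf⟩ := h p hp
  obtain ⟨m, n, F, G, hF, hG, hmn, hGp, h⟩ := hf p ⟨hp, hpW⟩
  obtain ⟨k, B, hB, hBp, hBW⟩ := exists_form_of_isOpen hW hpW
  refine ⟨m + k, n + k, F * B, G * B, hF.mul hB, hG.mul hB, by push_cast; omega, ?_, ?_⟩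
  · rw [val_mul]; exact mul_ne_zero hGp hBp
  · intro q hq hGq
    rw [val_mul] at hGq
    have hBq := right_ne_zero_of_mul hGq
    rw [val_mul, val_mul, mul_div_mul_right _ _ hBq]
    exact h q ⟨hq, hBW q hBq⟩ (left_ne_zero_of_mul hGq)

theorem exists_glue {ι : Type*} {U : ι → Set P1} (hU : ∀ i, @IsOpen _ zariski (U i))
    {f : ι → P1 → ℂ} (hf : ∀ i, RegDeg d (U i) (f i))
    (h : ∀ i j p, p ∈ U i → p ∈ U j → f i p = f j p) :
    ∃ g, RegDeg d (⋃ i, U i) g ∧ ∀ i, ∀ p ∈ U i, g p = f i p := by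
  classical
  let g : P1 → ℂ := fun p => if hp : ∃ i, p ∈ U i then f hp.choose p else 0
  have hg : ∀ i, ∀ p ∈ U i, g p = f i p := by
    intro i p hp
    have hex : ∃ i, p ∈ U i := ⟨i, hp⟩
    simp only [g, dif_pos hex]
    exact h _ _ p hex.choose_spec hp
  refine ⟨g, of_locally fun p hp => ?_, hg⟩
  obtain ⟨i, hi⟩ := Set.mem_iUnion.1 hp
  exact ⟨U i, hU i, hi, ((hf i).mono Set.inter_subset_right).congr fun q hq => hg i q hq.2⟩

end RegDeg

theorem isHomogeneous_of_linForm_mul {p : P1} {F : MvPolynomial (Fin 2) ℂ} {n : ℕ}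
    (h : (linForm p * F).IsHomogeneous (n + 1)) : F.IsHomogeneous n := by
  by_cases hF : F = 0
  · rw [hF]; exact isHomogeneous_zero _ _ _
  · obtain ⟨k, hk, hFk⟩ := isHomogeneous_of_mul (linForm_isHomogeneous p) (linForm_ne_zero p) h hF
    obtain rfl : k = n := by omega
    exact hFk

theorem isHomogeneous_zero_iff_eq_C {F : MvPolynomial (Fin 2) ℂ} (hF : F.IsHomogeneous 0) :
    ∃ a, F = C a :=
  ⟨_, totalDegree_eq_zero_iff_eq_C.1 (Nat.le_zero.1 hF.totalDegree_le)⟩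

/-- A regular function on the projective line is constant. -/
theorem RegularP1.eq_of_univ {f : P1 → ℂ} (hf : RegularP1 Set.univ f) (p q : P1) : f p = f q := by
  have hf' : ∀ p, ∃ (n : ℕ) (F G : MvPolynomial (Fin 2) ℂ), F.IsHomogeneous n ∧
      G.IsHomogeneous n ∧ val G p ≠ 0 ∧ ∀ q, val G q ≠ 0 → f q = val F q / val G q := by
    intro p
    obtain ⟨n, F, G, hF, hG, hGp, h⟩ := hf p trivial
    exact ⟨n, F, G, hF, hG, hGp, fun q => h q trivial⟩
  choose n F G hF hG hGp hfG using hf'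
  have hG0 : ∀ p, G p ≠ 0 := fun p h => hGp p (by simp [h, val])
  have key : ∀ (m : ℕ) (A B : MvPolynomial (Fin 2) ℂ), A.IsHomogeneous m → B.IsHomogeneous m →
      B ≠ 0 → (∀ q, F q * B = A * G q) → ∃ c, ∀ q, f q = c := by
    intro m
    induction m with
    | zero =>
      intro A B hA hB hB0 h
      obtain ⟨a, rfl⟩ := isHomogeneous_zero_iff_eq_C hA
      obtain ⟨b, rfl⟩ := isHomogeneous_zero_iff_eq_C hB
      have hb : b ≠ 0 := by rintro rfl; simp at hB0
      refine ⟨a / b, fun q => ?_⟩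
      rw [hfG q q (hGp q), div_eq_div_iff (hGp q) hb]
      simpa [val] using congrArg (fun P => val P q) (h q)
    | succ m ih =>
      intro A B hA hB hB0 h
      -- A zero `p` of `B` is also a zero of `A`, since the local denominator `G p` does not vanish
      -- at `p`. The common linear factor cancels and the degree drops.
      obtain ⟨p, hp⟩ := exists_val_eq_zero hB (Nat.succ_ne_zero m)
      have hAp : val A p = 0 := by
        have := congrArg (fun P => val P p) (h p)
        simp only [val_mul, hp, mul_zero] at this
        exact (mul_eq_zero.1 this.symm).resolve_right (hGp p)
      obtain ⟨A', rfl⟩ := (linForm_dvd_iff p hA).2 hAp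
      obtain ⟨B', rfl⟩ := (linForm_dvd_iff p hB).2 hp
      refine ih A' B' (isHomogeneous_of_linForm_mul hA) (isHomogeneous_of_linForm_mul hB)
        (right_ne_zero_of_mul hB0) fun q => mul_left_cancel₀ (linForm_ne_zero p) ?_
      linear_combination h q
  obtain ⟨c, hc⟩ := key (n p) (F p) (G p) (hF p) (hG p) (hG0 p) fun q => by
    rw [← sub_eq_zero]
    -- Two local fractions agree where both denominators are nonzero, which suffices for an identity
    -- of forms.
    refine form_eq_zero (n := n q + n p) (B := G p * G q) ?_ ((hG p).mul (hG q))
      (mul_ne_zero (hG0 p) (hG0 q)) fun r hr => ?_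
    · refine ((hF q).mul (hG p)).sub ?_
      rw [add_comm]
      exact (hF p).mul (hG q)
    · rw [val_mul] at hr
      have h1 := hfG p r (left_ne_zero_of_mul hr)
      rw [hfG q r (right_ne_zero_of_mul hr), div_eq_div_iff (right_ne_zero_of_mul hr)
        (left_ne_zero_of_mul hr)] at h1
      simpa [val, sub_eq_zero] using h1
  rw [hc p, hc q]

/-! ### Descent of functions to the curve -/

theorem proj_marked (k : Fin 3) : proj (marked k) = triple := (proj_eq_triple_iff _).2 ⟨k, rfl⟩

theorem isOpen_preimage_proj {U : Set Curve} (hU : IsOpen U) : @IsOpen _ zariski (proj ⁻¹' U) :=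
  isOpen_coinduced.1 hU

/-- A function on the projective line that takes equal values at `0`, `1`, `∞` descends. -/
theorem apply_lift_proj {f : P1 → ℂ} {U : Set Curve}
    (h : triple ∈ U → ∀ k l, f (marked k) = f (marked l)) {p : P1} (hp : proj p ∈ U) :
    f (lift (proj p)) = f p := by
  by_cases ht : proj p = triple
  · obtain ⟨k, rfl⟩ := (proj_eq_triple_iff p).1 ht
    -- `lift` sends the triple point to an unspecified marked point, so the values at all marked
    -- points have to agree.
    obtain ⟨l, hl⟩ := (proj_eq_triple_iff (lift (proj (marked k)))).1 ((proj_lift _).trans ht)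
    rw [← hl]
    exact h (ht ▸ hp) l k
  · rw [lift_proj ht]

theorem regular_comp_lift {f : P1 → ℂ} {U : Set Curve} (hf : RegDeg 0 (proj ⁻¹' U) f)
    (h : triple ∈ U → ∀ k l, f (marked k) = f (marked l)) : Regular U (f ∘ lift) :=
  regDeg_zero_iff.1 (hf.congr fun _ hp => apply_lift_proj h hp)

theorem Regular.regDeg {U : Set Curve} {f : Curve → ℂ} (hf : Regular U f) :
    RegDeg 0 (proj ⁻¹' U) (fun p => f (proj p)) := regDeg_zero_iff.2 hf

/-- Linear forms without zeros on the charts of `𝒪(x)`, whose quotients are the transition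
functions. -/
noncomputable def pointForm (x : Curve) : Bool → MvPolynomial (Fin 2) ℂ
  | false => linForm (lift x)
  | true => C ((lift x).rep 1) * X 1

theorem pointForm_isHomogeneous (x : Curve) : ∀ β, (pointForm x β).IsHomogeneous 1 := by
  rintro (_ | _)
  · exact linForm_isHomogeneous _
  · exact isHomogeneous_den _

theorem val_pointForm_ne_zero {x : Curve} (hx : x ≠ triple) :
    ∀ {β p}, proj p ∈ pointChart x β → val (pointForm x β) p ≠ 0 := by
  rintro (_ | _) p hp
  · rw [Ne, pointForm, val_linForm_eq_zero_iff]
    rintro rfl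
    exact hp (proj_lift x)
  · exact val_den_ne_zero hp hx

theorem pointG_eq {x : Curve} (hx : x ≠ triple) : ∀ {β γ p}, proj p ∈ pointChart x β →
    proj p ∈ pointChart x γ →
    pointG x β γ (proj p) = val (pointForm x γ) p / val (pointForm x β) p := by
  rintro (_ | _) (_ | _) p h1 h2
  · exact (div_self (val_pointForm_ne_zero hx h1)).symm
  · simp only [pointG, coord_sub_eq h2 hx, inv_div, pointForm]
  · simp only [pointG, coord_sub_eq h1 hx, pointForm]
  · exact (div_self (val_pointForm_ne_zero hx h1)).symm

/-! ### Isomorphisms of the pullback with 𝒪(-1) -/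

namespace LineBundle

/-- Isomorphisms of the pullback of `L` with `𝒪(-1)`, in terms of the coefficients of the images of
the local frames with respect to the chosen representatives. -/
structure TautCoef (L : LineBundle) (lam : L.ι → P1 → ℂ) : Prop where
  ne_zero : ∀ i p, proj p ∈ L.chart i → lam i p ≠ 0
  regDeg : ∀ i, RegDeg (-1) (proj ⁻¹' L.chart i) (lam i)
  trans : ∀ i j p, proj p ∈ L.chart i ∩ L.chart j → lam j p = L.g i j (proj p) * lam i p

theorem TautCoef.isTautIso {L : LineBundle} {lam : L.ι → P1 → ℂ} (h : L.TautCoef lam) :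
    L.IsTautIso fun i p => lam i p • p.rep := by
  refine ⟨fun i p hp => ⟨?_, smul_ne_zero (h.ne_zero i p hp) p.rep_nonzero⟩, fun i l => ?_,
    fun i j p hp => ?_⟩
  · rw [Projectivization.submodule_eq]
    exact Submodule.smul_mem _ _ (Submodule.mem_span_singleton_self _)
  · rw [← regDeg_zero_iff]
    have hX := regDeg_val (isHomogeneous_X ℂ l) (proj ⁻¹' L.chart i)
    exact ((h.regDeg i).mul hX).congr fun p _ => by simp [val]
  · simp only [h.trans i j p hp, mul_smul]

theorem IsTautIso.exists_tautCoef {L : LineBundle} {s : L.ι → P1 → Fin 2 → ℂ}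
    (h : L.IsTautIso s) :
    ∃ lam, L.TautCoef lam ∧ ∀ i p, proj p ∈ L.chart i → s i p = lam i p • p.rep := by
  have hex : ∀ i p, ∃ a : ℂ, proj p ∈ L.chart i → s i p = a • p.rep := by
    intro i p
    by_cases hp : proj p ∈ L.chart i
    · have hs := (h.1 i p hp).1
      rw [Projectivization.submodule_eq, Submodule.mem_span_singleton] at hs
      obtain ⟨a, ha⟩ := hs
      exact ⟨a, fun _ => ha.symm⟩
    · exact ⟨0, fun hp' => absurd hp' hp⟩
  choose lam hlam using hex
  refine ⟨lam, ⟨fun i p hp h0 => (h.1 i p hp).2 ?_, fun i => ?_, fun i j p hp => ?_⟩, hlam⟩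
  · rw [hlam i p hp, h0, zero_smul]
  -- Near `p` the coefficient is the regular coordinate `s i · k` divided by the nonvanishing form
  -- `X k`, hence of degree -1.
  · refine RegDeg.of_locally fun p hp => ?_
    obtain ⟨k, hk⟩ : ∃ k, p.rep k ≠ 0 := by
      rcases rep_zero_ne_zero_or p with h | h <;> exact ⟨_, h⟩
    refine ⟨{q | val (X k) q ≠ 0}, TopologicalSpace.isOpen_generateFrom_of_mem
      ⟨X k, 1, isHomogeneous_X _ _, rfl⟩, by simpa [val] using hk, ?_⟩
    have h1 := (regDeg_zero_iff.2 (h.2.1 i k)).mono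
      (Set.inter_subset_left (t := {q | val (X k) q ≠ 0}))
    refine (h1.div (regDeg_val (isHomogeneous_X ℂ k) _) fun q hq => hq.2).congr fun q hq => ?_
    have hq2 : q.rep k ≠ 0 := by simpa [val] using hq.2
    rw [hlam i q hq.1]
    simp [val, hq2]
  · have h1 := h.2.2 i j p hp
    rw [hlam i p hp.1, hlam j p hp.2, smul_smul] at h1
    exact smul_left_injective ℂ p.rep_nonzero h1

theorem g_self {L : LineBundle} (i : L.ι) {c : Curve} (hc : c ∈ L.chart i) : L.g i i c = 1 :=
  mul_left_cancel₀ (L.g_ne_zero i i c ⟨hc, hc⟩)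
    ((L.cocycle i i i c ⟨⟨hc, hc⟩, hc⟩).trans (mul_one _).symm)

/-- Two isomorphisms of the pullback of `L` with `𝒪(-1)` differ by a constant. -/
theorem TautCoef.exists_eq_mul {L : LineBundle} {lam mu : L.ι → P1 → ℂ} (hl : L.TautCoef lam)
    (hm : L.TautCoef mu) :
    ∃ c : ℂ, c ≠ 0 ∧ ∀ i p, proj p ∈ L.chart i → mu i p = c * lam i p := by
  -- The transition functions cancel in the quotients `mu i / lam i`, which glue to a global regular
  -- function.
  obtain ⟨f, hf, hfi⟩ := RegDeg.exists_glue (d := 0) (fun i => isOpen_preimage_proj (L.isOpen_chart i))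
    (f := fun i p => mu i p / lam i p)
    (fun i => by simpa using (hm.regDeg i).div (hl.regDeg i) (hl.ne_zero i))
    (fun i j p hi hj => by
      have hg := L.g_ne_zero i j _ ⟨hi, hj⟩
      simp only [hl.trans i j p ⟨hi, hj⟩, hm.trans i j p ⟨hi, hj⟩]
      rw [mul_div_mul_left _ _ hg])
  have hU : (⋃ i, proj ⁻¹' L.chart i) = Set.univ := by
    rw [Set.eq_univ_iff_forall]
    intro p
    obtain ⟨i, hi⟩ := L.cover (proj p)
    exact Set.mem_iUnion.2 ⟨i, hi⟩
  rw [hU, regDeg_zero_iff] at hf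
  obtain ⟨i0, hi0⟩ := L.cover triple
  have h0 : proj (marked 0) ∈ L.chart i0 := hi0
  refine ⟨f (marked 0), ?_, fun i p hp => ?_⟩
  · rw [hfi i0 _ h0]
    exact div_ne_zero (hm.ne_zero i0 _ h0) (hl.ne_zero i0 _ h0)
  · rw [hf.eq_of_univ (marked 0) p, hfi i p hp, div_mul_cancel₀ _ (hl.ne_zero i p hp)]

theorem TautCoef.const_mul {L : LineBundle} {lam : L.ι → P1 → ℂ} (hl : L.TautCoef lam)
    {c : ℂ} (hc : c ≠ 0) : L.TautCoef fun i p => c * lam i p := by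
  refine ⟨fun i p hp => mul_ne_zero hc (hl.ne_zero i p hp), fun i => ?_, fun i j p hp => ?_⟩
  · have hC := regDeg_val (isHomogeneous_C (Fin 2) c) (proj ⁻¹' L.chart i)
    exact (hC.mul (hl.regDeg i)).congr fun p _ => by simp [val]
  · rw [hl.trans i j p hp]; ring

/-- Pulling back an isomorphism with `𝒪(-1)` along an isomorphism of line bundles. -/
theorem Isomorphic.exists_tautCoef {L M : LineBundle} {mu : M.ι → P1 → ℂ}
    (h : L.Isomorphic M) (hm : M.TautCoef mu) :
    ∃ lam, L.TautCoef lam ∧ ∀ i a, triple ∈ L.chart i → triple ∈ M.chart a →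
      ∃ c : ℂ, c ≠ 0 ∧ ∀ k, lam i (marked k) = c * mu a (marked k) := by
  obtain ⟨h, hreg, hne, hco⟩ := h
  -- On a fixed chart `i` of `L`, the products `h a i * mu a` agree on overlaps as the chart `a` of
  -- `M` varies.
  have hex := fun i => RegDeg.exists_glue (d := -1)
    (U := fun a => proj ⁻¹' (M.chart a ∩ L.chart i))
    (fun a => isOpen_preimage_proj ((M.isOpen_chart a).inter (L.isOpen_chart i)))
    (f := fun a p => h a i (proj p) * mu a p)
    (fun a => by
      simpa using (hreg a i).regDeg.mul ((hm.regDeg a).mono fun p hp => hp.1))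
    (fun a b p ha hb => by
      have h1 := hco a b i i (proj p) ⟨⟨ha.1, hb.1⟩, ⟨ha.2, ha.2⟩⟩
      rw [g_self i ha.2, mul_one] at h1
      simp only [hm.trans a b p ⟨ha.1, hb.1⟩, ← h1]
      ring)
  choose lam hlam hval using hex
  refine ⟨lam, ⟨fun i p hp => ?_, fun i => (hlam i).mono fun p hp => ?_, fun i j p hp => ?_⟩,
    fun i a hi ha => ⟨h a i triple, hne a i _ ⟨ha, hi⟩, fun k => ?_⟩⟩
  · obtain ⟨a, ha⟩ := M.cover (proj p)
    rw [hval i a p ⟨ha, hp⟩]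
    exact mul_ne_zero (hne a i _ ⟨ha, hp⟩) (hm.ne_zero a p ha)
  · obtain ⟨a, ha⟩ := M.cover (proj p)
    exact Set.mem_iUnion.2 ⟨a, ha, hp⟩
  · obtain ⟨a, ha⟩ := M.cover (proj p)
    have h1 := hco a a i j (proj p) ⟨⟨ha, ha⟩, hp⟩
    rw [g_self a ha, one_mul] at h1
    rw [hval i a p ⟨ha, hp.1⟩, hval j a p ⟨ha, hp.2⟩, h1]
    ring
  · have hk : proj (marked k) ∈ M.chart a ∩ L.chart i := by rw [proj_marked]; exact ⟨ha, hi⟩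
    rw [hval i a _ hk, proj_marked]

/-- Isomorphisms with `𝒪(-1)` with proportional values at `0`, `1`, `∞` induce an isomorphism. -/
theorem TautCoef.isomorphic {L M : LineBundle} {lam : L.ι → P1 → ℂ} {mu : M.ι → P1 → ℂ}
    (hl : L.TautCoef lam) (hm : M.TautCoef mu) {i0 : L.ι} {a0 : M.ι} (hi0 : triple ∈ L.chart i0)
    (ha0 : triple ∈ M.chart a0) {c : ℂ}
    (hc : ∀ k, lam i0 (marked k) = c * mu a0 (marked k)) : L.Isomorphic M := by
  -- The right side does not involve `k`, so `lam i / mu a` descends to the curve.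
  have hmk : ∀ i a, triple ∈ M.chart a ∩ L.chart i → ∀ k,
      lam i (marked k) / mu a (marked k) = L.g i0 i triple * c / M.g a0 a triple := by
    rintro i a ⟨ha, hi⟩ k
    have h1 := hl.trans i0 i (marked k) (by rw [proj_marked]; exact ⟨hi0, hi⟩)
    have h2 := hm.trans a0 a (marked k) (by rw [proj_marked]; exact ⟨ha0, ha⟩)
    have h3 : mu a0 (marked k) ≠ 0 := hm.ne_zero _ _ (by rwa [proj_marked])
    rw [h1, h2, proj_marked, hc, ← mul_assoc, mul_div_mul_right _ _ h3]
  refine ⟨fun a i => (fun p => lam i p / mu a p) ∘ lift, fun a i => ?_, fun a i p hp => ?_,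
    fun a b i j p hp => ?_⟩
  · refine regular_comp_lift ?_ fun ht k l => by rw [hmk i a ht, hmk i a ht]
    simpa using ((hl.regDeg i).mono (V := proj ⁻¹' (M.chart a ∩ L.chart i)) fun p hp => hp.2).div
      ((hm.regDeg a).mono fun p hp => hp.1) fun p hp => hm.ne_zero a p hp.1
  · exact div_ne_zero (hl.ne_zero _ _ (by rw [proj_lift]; exact hp.2))
      (hm.ne_zero _ _ (by rw [proj_lift]; exact hp.1))
  · have h1 := hl.trans i j (lift p) (by rw [proj_lift]; exact hp.2)
    have h2 := hm.trans a b (lift p) (by rw [proj_lift]; exact hp.1)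
    have h3 := hm.ne_zero a (lift p) (by rw [proj_lift]; exact hp.1.1)
    have h4 := M.g_ne_zero a b p hp.1
    simp only [Function.comp_apply, h1, h2, proj_lift]
    field_simp

/-! ### Twisting by a smooth point -/

/-- A line bundle which becomes trivial after twisting by `x` has an isomorphism of
its pullback with `𝒪(-1)` that is given by the inverse of a linear form vanishing at `x`. -/
theorem exists_tautCoef_of_twist {L : LineBundle} {x : {c : Curve // c ≠ triple}}
    (h : (L.twist x).Isomorphic trivial) :
    ∃ lam, L.TautCoef lam ∧ ∀ i, triple ∈ L.chart i → ∃ c : ℂ, c ≠ 0 ∧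
      ∀ k, lam i (marked k) = c / val (linForm (lift x.1)) (marked k) := by
  obtain ⟨h, hreg, hne, hco⟩ := h
  let H : L.ι → Bool → Curve → ℂ := fun i β => h () (i, β)
  have hregH : ∀ i β, RegDeg 0 (proj ⁻¹' (L.chart i ∩ pointChart x β)) (fun p => H i β (proj p)) :=
    fun i β => (hreg () (i, β)).regDeg.mono fun p hp => ⟨Set.mem_univ _, hp⟩
  have hneH : ∀ i β c, c ∈ L.chart i → c ∈ pointChart x β → H i β c ≠ 0 :=
    fun i β c h1 h2 => hne () (i, β) c ⟨Set.mem_univ _, h1, h2⟩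
  have hcoH : ∀ i j β γ c, c ∈ L.chart i → c ∈ L.chart j → c ∈ pointChart x β →
      c ∈ pointChart x γ → H j γ c = H i β c * (L.g i j c * pointG x β γ c) := by
    intro i j β γ c h1 h2 h3 h4
    have := hco () () (i, β) (j, γ) c ⟨⟨Set.mem_univ _, Set.mem_univ _⟩, ⟨h1, h3⟩, ⟨h2, h4⟩⟩
    rw [show trivial.g () () c = 1 from rfl, one_mul] at this
    exact this
  have hopen : ∀ β, IsOpen (pointChart x β) := (pointBundle x).isOpen_chart
  have hcover : ∀ c, ∃ β, c ∈ pointChart x β := (pointBundle x).cover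
  -- Dividing a trivialization of the twist by the linear form of the chart `β` removes the
  -- transition function of 𝒪(x), which is a quotient of these forms, and lowers the degree to -1.
  have hex := fun i => RegDeg.exists_glue (d := -1)
    (U := fun β => proj ⁻¹' (L.chart i ∩ pointChart x β))
    (fun β => isOpen_preimage_proj ((L.isOpen_chart i).inter (hopen β)))
    (f := fun β p => H i β (proj p) / val (pointForm x.1 β) p)
    (fun β => by
      simpa using (hregH i β).div (regDeg_val (pointForm_isHomogeneous x.1 β) _)
        fun p hp => val_pointForm_ne_zero x.2 hp.2)
    (fun β γ p hβ hγ => by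
      have := val_pointForm_ne_zero x.2 hβ.2
      have := val_pointForm_ne_zero x.2 hγ.2
      simp only [hcoH i i β γ _ hβ.1 hβ.1 hβ.2 hγ.2, pointG_eq x.2 hβ.2 hγ.2, g_self i hβ.1]
      field_simp)
  choose lam hlam hval using hex
  refine ⟨lam, ⟨fun i p hp => ?_, fun i => (hlam i).mono fun p hp => ?_, fun i j p hp => ?_⟩,
    fun i hi => ⟨H i false triple, hneH i false _ hi fun h => x.2 h.symm, fun k => ?_⟩⟩
  · obtain ⟨β, hβ⟩ := hcover (proj p)
    rw [hval i β p ⟨hp, hβ⟩]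
    exact div_ne_zero (hneH i β _ hp hβ) (val_pointForm_ne_zero x.2 hβ)
  · obtain ⟨β, hβ⟩ := hcover (proj p)
    exact Set.mem_iUnion.2 ⟨β, hp, hβ⟩
  · obtain ⟨β, hβ⟩ := hcover (proj p)
    have := val_pointForm_ne_zero x.2 hβ
    rw [hval i β p ⟨hp.1, hβ⟩, hval j β p ⟨hp.2, hβ⟩, hcoH i j β β _ hp.1 hp.2 hβ hβ,
      pointG_eq x.2 hβ hβ]
    field_simp
  · rw [hval i false (marked k) (by rw [Set.mem_preimage, proj_marked]; exact ⟨hi, fun h => x.2 h.symm⟩),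
      proj_marked]
    rfl

/-- The products of `lam i` with the linear forms of 𝒪(x) trivialize the pulled-back twist. They
descend because, on the only chart of 𝒪(x) containing the triple point, the form is the one in `hc`,
so the values at the marked points agree. -/
theorem TautCoef.twist_isomorphic {L : LineBundle} {x : {c : Curve // c ≠ triple}}
    {lam : L.ι → P1 → ℂ} (hl : L.TautCoef lam) {i0 : L.ι} (hi0 : triple ∈ L.chart i0) {c : ℂ}
    (hc : ∀ k, lam i0 (marked k) = c / val (linForm (lift x.1)) (marked k)) :
    (L.twist x).Isomorphic trivial := by
  refine ⟨fun _ i => (fun p => lam i.1 p * val (pointForm x.1 i.2) p) ∘ lift, ?_, ?_, ?_⟩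
  · rintro _ ⟨i, β⟩
    refine regular_comp_lift ?_ ?_
    · simpa using ((hl.regDeg i).mul (regDeg_val (pointForm_isHomogeneous x.1 β) _)).mono fun p hp => hp.2.1
    · rintro ⟨_, hi, hβ⟩ k l
      obtain _ | _ := β
      · have key : ∀ k, lam i (marked k) * val (pointForm x.1 false) (marked k) = L.g i0 i triple * c := by
          intro k
          have h0 := val_pointForm_ne_zero x.2 (β := false) (p := marked k) (by rw [proj_marked]; exact hβ)
          rw [hl.trans i0 i (marked k) (by rw [proj_marked]; exact ⟨hi0, hi⟩), proj_marked, hc]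
          change L.g i0 i triple * (c / val (pointForm x.1 false) (marked k)) * _ = _
          field_simp
        simp only [key]
      · exact absurd rfl hβ
  · rintro _ ⟨i, β⟩ p ⟨_, hi, hβ⟩
    exact mul_ne_zero (hl.ne_zero _ _ (by rw [proj_lift]; exact hi))
      (val_pointForm_ne_zero x.2 (by rw [proj_lift]; exact hβ))
  · rintro _ _ ⟨i, β⟩ ⟨j, γ⟩ p ⟨_, ⟨hi, hβ⟩, ⟨hj, hγ⟩⟩
    have h1 := hl.trans i j (lift p) (by rw [proj_lift]; exact ⟨hi, hj⟩)
    have h2 := pointG_eq x.2 (β := β) (γ := γ) (p := lift p) (by rw [proj_lift]; exact hβ) (by rw [proj_lift]; exact hγ)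
    have h3 := val_pointForm_ne_zero x.2 (β := β) (p := lift p) (by rw [proj_lift]; exact hβ)
    rw [proj_lift] at h1 h2
    change 1 * (lam j (lift p) * val (pointForm x.1 γ) (lift p)) = lam i (lift p) * val (pointForm x.1 β) (lift p) *
      (L.g i j p * pointG x β γ p)
    rw [h1, h2]
    field_simp

end LineBundle

/-! ### Degree -1 implies a pullback isomorphic to 𝒪(-1) -/

theorem val_ne_zero_imp {F : MvPolynomial (Fin 2) ℂ} {p : P1} (h : val F p ≠ 0) : F ≠ 0 := by
  rintro rfl
  simp [val] at h

theorem ord_one (p : P1) : ord p 1 = 0 :=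
  ord_eq_zero (isHomogeneous_one _ _) (by simp [val])

/-- Forms with prescribed zeros. -/
theorem exists_form_ord_eq (E : P1 →₀ ℕ) : ∃ A : MvPolynomial (Fin 2) ℂ,
    A.IsHomogeneous (E.sum fun _ m => m) ∧ A ≠ 0 ∧ ∀ p, ord p A = E p := by
  induction E using Finsupp.induction_linear with
  | zero => exact ⟨1, by simpa using isHomogeneous_one _ _, one_ne_zero, fun p => ord_one p⟩
  | add E E' h h' =>
    obtain ⟨A, hA, hA0, hE⟩ := h
    obtain ⟨A', hA', hA0', hE'⟩ := h'
    refine ⟨A * A', ?_, mul_ne_zero hA0 hA0', fun p => ?_⟩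
    · rw [Finsupp.sum_add_index' (fun _ => rfl) (fun _ _ _ => rfl)]
      exact hA.mul hA'
    · rw [ord_mul p hA0 hA0', hE, hE', Finsupp.add_apply]
  | single q m =>
    refine ⟨linForm q ^ m, ?_, pow_ne_zero _ (linForm_ne_zero q), fun p => ?_⟩
    · simpa using (linForm_isHomogeneous q).pow m
    · by_cases h : p = q
      · rw [h, Finsupp.single_eq_same]
        exact multiplicity_pow_self_of_prime (prime_linForm q) m
      · rw [Finsupp.single_eq_of_ne h]
        refine ord_eq_zero ((linForm_isHomogeneous q).pow m) ?_
        have : val (linForm q) p ≠ 0 := (val_linForm_eq_zero_iff q p).not.2 h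
        simpa [val] using fun h0 => absurd h0 this

/-- A quotient of forms, reduced at a point. -/
theorem exists_reduced {N M : MvPolynomial (Fin 2) ℂ} {n m : ℕ} (hN : N.IsHomogeneous n)
    (hM : M.IsHomogeneous m) (hN0 : N ≠ 0) (hM0 : M ≠ 0) {p : P1} (h : ord p N = ord p M) :
    ∃ (u v : ℕ) (U V : MvPolynomial (Fin 2) ℂ), U.IsHomogeneous u ∧ V.IsHomogeneous v ∧
      n + v = m + u ∧ N * V = M * U ∧ val U p ≠ 0 ∧ val V p ≠ 0 := by
  obtain ⟨U, hU, hUp⟩ := (finiteMultiplicity_linForm p hN0).exists_eq_pow_mul_and_not_dvd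
  obtain ⟨V, hV, hVp⟩ := (finiteMultiplicity_linForm p hM0).exists_eq_pow_mul_and_not_dvd
  change N = linForm p ^ ord p N * U at hU
  change M = linForm p ^ ord p M * V at hV
  have hl := pow_ne_zero (ord p N) (linForm_ne_zero p)
  have hlh := (linForm_isHomogeneous p).pow (ord p N)
  rw [← h] at hV
  obtain ⟨u, hu, hU'⟩ := isHomogeneous_of_mul hlh hl (hU ▸ hN)
    (right_ne_zero_of_mul (hU ▸ hN0))
  obtain ⟨v, hv, hV'⟩ := isHomogeneous_of_mul hlh hl (hV ▸ hM)
    (right_ne_zero_of_mul (hV ▸ hM0))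
  refine ⟨u, v, U, V, hU', hV', by omega, ?_, (linForm_dvd_iff p hU').not.1 hUp,
    (linForm_dvd_iff p hV').not.1 hVp⟩
  linear_combination V * hU - U * hV

/-- At each point of `S` a fraction equal to `N / M` is chosen in which neither term vanishes there.
Any two choices have the same cross products with `N` and `M`, so one choice computes `f` wherever
its denominator is nonzero on `S`. -/
theorem exists_regDeg_of_ord_eq {N M : MvPolynomial (Fin 2) ℂ} {n m : ℕ} {d : ℤ}
    (hN : N.IsHomogeneous n) (hM : M.IsHomogeneous m) (hN0 : N ≠ 0) (hM0 : M ≠ 0)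
    (hd : (n : ℤ) = m + d) {S : Set P1} (h : ∀ p ∈ S, ord p N = ord p M) :
    ∃ f, RegDeg d S f ∧ ∀ p ∈ S, ∃ U V, N * V = M * U ∧ val U p ≠ 0 ∧ val V p ≠ 0 ∧
      f p = val U p / val V p := by
  have hex : ∀ p, ∃ (u v : ℕ) (U V : MvPolynomial (Fin 2) ℂ), p ∈ S → U.IsHomogeneous u ∧
      V.IsHomogeneous v ∧ n + v = m + u ∧ N * V = M * U ∧ val U p ≠ 0 ∧ val V p ≠ 0 := by
    intro p
    by_cases hp : p ∈ S
    · obtain ⟨u, v, U, V, h⟩ := exists_reduced hN hM hN0 hM0 (h p hp)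
      exact ⟨u, v, U, V, fun _ => h⟩
    · exact ⟨0, 0, 0, 0, fun hp' => absurd hp' hp⟩
  choose u v U V hUV using hex
  refine ⟨fun p => val (U p) p / val (V p) p, fun p hp => ?_, fun p hp => ?_⟩
  · obtain ⟨hU, hV, huv, hNV, hUp, hVp⟩ := hUV p hp
    refine ⟨u p, v p, U p, V p, hU, hV, by omega, hVp, fun q hq hVq => ?_⟩
    obtain ⟨-, -, -, hNV', hUq', hVq'⟩ := hUV q hq
    rw [div_eq_div_iff hVq' hVq, ← val_mul, ← val_mul]
    congr 1
    refine mul_left_cancel₀ (mul_ne_zero hN0 hM0) ?_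
    linear_combination N * V p * (-hNV') + N * V q * hNV
  · obtain ⟨-, -, -, h⟩ := hUV p hp
    exact ⟨U p, V p, h.1, h.2.1, h.2.2, rfl⟩

namespace LineBundle

/-- The pullback of a line bundle of degree `-1` is isomorphic with `𝒪(-1)`. -/
theorem HasDegree.exists_tautCoef {L : LineBundle} (h : L.HasDegree (-1)) :
    ∃ lam, L.TautCoef lam := by
  obtain ⟨n, F, G, D, hFG, hco, hD, hdeg⟩ := h
  -- `A` and `B` carry the positive and negative parts of `D`, so `A / B` has divisor `D` and degree
  -- -1 as a fraction.
  obtain ⟨A, hA, hA0, hAo⟩ := exists_form_ord_eq (D.mapRange Int.toNat rfl)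
  obtain ⟨B, hB, hB0, hBo⟩ := exists_form_ord_eq (D.mapRange (fun m => (-m).toNat) rfl)
  rw [Finsupp.sum_mapRange_index fun _ => rfl] at hA hB
  set a := D.sum fun _ m => m.toNat with ha
  set b := D.sum fun _ m => (-m).toNat with hb
  have hab : (a : ℤ) = b + (-1) := by
    rw [← hdeg, ha, hb, Finsupp.sum, Finsupp.sum, Finsupp.sum]
    push_cast
    rw [← Finset.sum_add_distrib]
    refine Finset.sum_congr rfl fun p _ => ?_
    omega
  -- The function `lam i` is `A / B` divided by the local section `F i / G i`: the divisors cancel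
  -- on the chart.
  have hex : ∀ i, ∃ f, RegDeg (-1) (proj ⁻¹' L.chart i) f ∧ ∀ p ∈ proj ⁻¹' L.chart i,
      ∃ U V, (G i * A) * V = (F i * B) * U ∧ val U p ≠ 0 ∧ val V p ≠ 0 ∧
        f p = val U p / val V p := by
    intro i
    obtain ⟨hF, hG, hF0, hG0⟩ := hFG i
    refine exists_regDeg_of_ord_eq (hG.mul hA) (hF.mul hB) (mul_ne_zero hG0 hA0)
      (mul_ne_zero hF0 hB0) (by push_cast; omega) fun p hp => ?_
    rw [ord_mul p hG0 hA0, ord_mul p hF0 hB0, hAo, hBo, Finsupp.mapRange_apply,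
      Finsupp.mapRange_apply]
    have := hD i p hp
    omega
  choose lam hreg hlam using hex
  refine ⟨lam, fun i p hp => ?_, hreg, fun i j p hp => ?_⟩
  · obtain ⟨U, V, -, hU, hV, h⟩ := hlam i p hp
    rw [h]
    exact div_ne_zero hU hV
  · obtain ⟨U, V, hUV, hU, hV, h⟩ := hlam i p hp.1
    obtain ⟨U', V', hUV', hU', hV', h'⟩ := hlam j p hp.2
    obtain ⟨r, P, R, hP, hR, hRp, hg⟩ := L.regular_g i j p hp
    obtain ⟨k, C, hC, hCp, hCW⟩ := exists_form_of_isOpen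
      (isOpen_preimage_proj ((L.isOpen_chart i).inter (L.isOpen_chart j))) (p := p) hp
    obtain ⟨hFi, hGi, hFi0, hGi0⟩ := hFG i
    obtain ⟨hFj, hGj, hFj0, hGj0⟩ := hFG j
    -- At `p` itself the section identity may read `0 = 0`. It is lifted to an identity of forms,
    -- where the vanishing factors can be cancelled before evaluating.
    have key : F i * G j * R - P * (F j * G i) = 0 := by
      refine form_eq_zero (n := n i + n j + r) (B := C * R) ?_ (hC.mul hR)
        (mul_ne_zero (val_ne_zero_imp hCp) (val_ne_zero_imp hRp)) fun q hq => ?_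
      · refine ((hFi.mul hGj).mul hR).sub ?_
        rw [show n i + n j + r = r + (n j + n i) by ring]
        exact hP.mul (hFj.mul hGi)
      · rw [val_mul] at hq
        have hqW := hCW q (left_ne_zero_of_mul hq)
        have hRq := right_ne_zero_of_mul hq
        have h1 := hco i j q hqW
        have h2 := hg q hqW hRq
        simp only [Function.comp_apply] at h2
        rw [h2] at h1
        have h3 : val (F i) q * val (G j) q * val R q
            = val P q * (val (F j) q * val (G i) q) := by
          rw [h1]; field_simp
        simpa [val, sub_eq_zero] using h3
    have key2 : U' * V * R = P * V' * U := by
      refine mul_left_cancel₀ (mul_ne_zero (mul_ne_zero hFj0 hFi0) hB0) ?_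
      linear_combination -F i * V * R * hUV' + A * V * V' * key + P * V' * F j * hUV
    have h4 := hg p hp hRp
    simp only [Function.comp_apply] at h4
    have h5 := congrArg (fun Q => val Q p) key2
    simp only [val_mul] at h5
    rw [h, h', h4]
    field_simp
    linear_combination h5

/-! ### Construction of bundles of degree -1 -/

/-- The line bundle on the curve given by local trivializations `lam i` of `𝒪(-1)` that are
compatible with the gluing. -/
noncomputable def ofCoef (ι : Type) (chart : ι → Set Curve) (isOpen_chart : ∀ i, IsOpen (chart i))
    (cover : ∀ c, ∃ i, c ∈ chart i) (lam : ι → P1 → ℂ)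
    (hne : ∀ i p, proj p ∈ chart i → lam i p ≠ 0)
    (hreg : ∀ i, RegDeg (-1) (proj ⁻¹' chart i) (lam i))
    (hmk : ∀ i j, triple ∈ chart i ∩ chart j → ∀ k l,
      lam j (marked k) / lam i (marked k) = lam j (marked l) / lam i (marked l)) : LineBundle where
  ι := ι
  chart := chart
  isOpen_chart := isOpen_chart
  cover := cover
  g i j := (fun p => lam j p / lam i p) ∘ lift
  regular_g i j := by
    refine regular_comp_lift ?_ (hmk i j)
    simpa using ((hreg j).mono (V := proj ⁻¹' (chart i ∩ chart j)) fun p hp => hp.2).div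
      ((hreg i).mono fun p hp => hp.1) fun p hp => hne i p hp.1
  g_ne_zero i j c hc := div_ne_zero (hne _ _ (by rw [proj_lift]; exact hc.2))
    (hne _ _ (by rw [proj_lift]; exact hc.1))
  cocycle i j k c hc := by
    have h1 := hne j (lift c) (by rw [proj_lift]; exact hc.1.2)
    have h2 := hne i (lift c) (by rw [proj_lift]; exact hc.1.1)
    simp only [Function.comp_apply]
    field_simp

theorem tautCoef_ofCoef {ι : Type} {chart : ι → Set Curve} {isOpen_chart : ∀ i, IsOpen (chart i)}
    {cover : ∀ c, ∃ i, c ∈ chart i} {lam : ι → P1 → ℂ}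
    {hne : ∀ i p, proj p ∈ chart i → lam i p ≠ 0}
    {hreg : ∀ i, RegDeg (-1) (proj ⁻¹' chart i) (lam i)}
    {hmk : ∀ i j, triple ∈ chart i ∩ chart j → ∀ k l,
      lam j (marked k) / lam i (marked k) = lam j (marked l) / lam i (marked l)} :
    (ofCoef ι chart isOpen_chart cover lam hne hreg hmk).TautCoef lam := by
  refine ⟨hne, hreg, fun i j p hp => ?_⟩
  have h := apply_lift_proj (f := fun p => lam j p / lam i p) (hmk i j) (p := p) hp
  change lam j p = lam j (lift (proj p)) / lam i (lift (proj p)) * lam i p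
  rw [h, div_mul_cancel₀ _ (hne i p hp.1)]

end LineBundle

theorem marked_two_rep_one : (marked 2).rep 1 = 0 := by
  obtain ⟨c, hc, h⟩ := exists_smul_rep (markedVec_ne_zero 2)
  have := congrFun h 1
  simp only [markedVec, Matrix.cons_val, Pi.smul_apply, smul_eq_mul] at this
  exact (mul_eq_zero.1 this.symm).resolve_left hc

/-- `X 1` is the linear form of ∞ up to a nonzero constant. -/
theorem ord_X_one (p : P1) : ord p (X 1) = Finsupp.single (marked 2) 1 p := by
  by_cases h : p = marked 2
  · rw [h, Finsupp.single_eq_same]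
    refine Eq.trans ?_ (ord_linForm_self (marked 2))
    refine multiplicity_eq_of_associated_right ?_
    have h0 : (marked 2).rep 0 ≠ 0 :=
      (rep_zero_ne_zero_or _).resolve_right fun h => h marked_two_rep_one
    have hu : IsUnit (C (-(marked 2).rep 0) : MvPolynomial (Fin 2) ℂ) :=
      (isUnit_iff_ne_zero.2 (neg_ne_zero.2 h0)).map C
    refine (associated_mul_unit_right _ _ hu).trans (Associated.of_eq ?_)
    rw [linForm, marked_two_rep_one, C_0, C_neg]
    ring
  · rw [Finsupp.single_eq_of_ne h]
    refine ord_eq_zero (isHomogeneous_X _ _) fun h0 => h ?_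
    rw [← val_linForm_eq_zero_iff, val_linForm, marked_two_rep_one]
    have : p.rep 1 = 0 := by simpa [val] using h0
    rw [this]; ring

theorem val_marked_ne_zero_iff {F : MvPolynomial (Fin 2) ℂ} {n : ℕ} (hF : F.IsHomogeneous n)
    (k : Fin 3) : val F (marked k) ≠ 0 ↔ eval (markedVec k) F ≠ 0 :=
  (val_mk_eq_zero_iff hF _).not

/-- Existence of line bundles of degree `-1` with a given trivialization `A / B` of `𝒪(-1)` at the
triple point. -/
theorem exists_lineBundle_of_forms {A B : MvPolynomial (Fin 2) ℂ} {n : ℕ}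
    (hA : A.IsHomogeneous n) (hB : B.IsHomogeneous (n + 1)) (hAm : ∀ k, val A (marked k) ≠ 0)
    (hBm : ∀ k, val B (marked k) ≠ 0) :
    ∃ L : LineBundle, L.HasDegree (-1) ∧ ∃ lam, L.TautCoef lam ∧
      ∃ i, triple ∈ L.chart i ∧ ∀ k, lam i (marked k) = val A (marked k) / val B (marked k) := by
  -- Off the triple point the trivialization is `1 / X 1`, as `X 1` vanishes only at ∞; on `{A * B ≠
  -- 0}`, which contains all marked points, it is `A / B`.
  let chart : Bool → Set Curve := fun β => if β then {triple}ᶜ else {c | val (A * B) (lift c) ≠ 0}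
  let lam : Bool → P1 → ℂ := fun β p => if β then (val (X 1) p)⁻¹ else val A p / val B p
  have hpre : ∀ p, proj p ∈ chart false ↔ val A p ≠ 0 ∧ val B p ≠ 0 := by
    intro p
    have hmk : ∀ k, val (A * B) (marked k) ≠ 0 := fun k => by
      rw [val_mul]; exact mul_ne_zero (hAm k) (hBm k)
    have : proj p ∈ chart false ↔ val (A * B) p ≠ 0 := by
      change val (A * B) (lift (proj p)) ≠ 0 ↔ _
      by_cases ht : proj p = triple
      · obtain ⟨k, hk⟩ := (proj_eq_triple_iff p).1 ht
        obtain ⟨l, hl⟩ := (proj_eq_triple_iff (lift (proj p))).1 ((proj_lift _).trans ht)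
        rw [← hl, ← hk]
        exact iff_of_true (hmk l) (hmk k)
      · rw [lift_proj ht]
    rw [this, val_mul, mul_ne_zero_iff]
  have htriple : triple ∈ chart false := by
    rw [← proj_marked 0, hpre]; exact ⟨hAm 0, hBm 0⟩
  have hX : ∀ p, proj p ∈ chart true → val (X 1) p ≠ 0 := fun p hp => by
    simpa [val] using rep_one_ne_zero hp
  have hopen : ∀ β, IsOpen (chart β) := by
    rintro (_ | _)
    · refine isOpen_coinduced.2 (TopologicalSpace.isOpen_generateFrom_of_mem
        ⟨A * B, _, hA.mul hB, ?_⟩)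
      ext p
      rw [Set.mem_preimage, hpre, Set.mem_ofPred_eq, val_mul, mul_ne_zero_iff]
    · exact isOpen_compl_triple
  have hcover : ∀ c, ∃ β, c ∈ chart β := by
    intro c
    by_cases h : c = triple
    · exact ⟨false, h ▸ htriple⟩
    · exact ⟨true, h⟩
  have hne : ∀ β p, proj p ∈ chart β → lam β p ≠ 0 := by
    rintro (_ | _) p hp
    · exact div_ne_zero ((hpre p).1 hp).1 ((hpre p).1 hp).2
    · exact inv_ne_zero (hX p hp)
  have hreg : ∀ β, RegDeg (-1) (proj ⁻¹' chart β) (lam β) := by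
    rintro (_ | _)
    · have := (regDeg_val hA (proj ⁻¹' chart false)).div (regDeg_val hB _)
        fun p hp => ((hpre p).1 hp).2
      convert this using 1
      · push_cast
        ring
      · rfl
    · exact (regDeg_val (isHomogeneous_X ℂ 1) _).inv hX
  have hmk : ∀ i j, triple ∈ chart i ∩ chart j → ∀ k l,
      lam j (marked k) / lam i (marked k) = lam j (marked l) / lam i (marked l) := by
    rintro (_ | _) (_ | _) h k l
    · rw [div_self (hne _ _ (by rw [proj_marked]; exact htriple)),
        div_self (hne _ _ (by rw [proj_marked]; exact htriple))]
    · exact absurd rfl h.2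
    · exact absurd rfl h.1
    · exact absurd rfl h.1
  have hA0 := val_ne_zero_imp (hAm 0)
  have hB0 := val_ne_zero_imp (hBm 0)
  have hX0 : (X 1 : MvPolynomial (Fin 2) ℂ) ≠ 0 := X_ne_zero 1
  refine ⟨.ofCoef Bool chart hopen hcover lam hne hreg hmk, ?_, lam, LineBundle.tautCoef_ofCoef,
    false, htriple, fun k => rfl⟩
  -- The degree is computed with the rational section `1 / X 1` of 𝒪(-1): it has coordinate 1 on one
  -- chart and `B / (A * X 1)` on the other, and its only pole is simple, at ∞.
  refine ⟨fun β : Bool => if β then 0 else n + 1, fun β : Bool => if β then 1 else B,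
    fun β : Bool => if β then 1 else A * X 1, Finsupp.single (marked 2) (-1), ?_, ?_, ?_,
    Finsupp.sum_single_index rfl⟩
  · rintro (_ | _)
    · exact ⟨hB, hA.mul (isHomogeneous_X _ _), hB0, mul_ne_zero hA0 hX0⟩
    · exact ⟨isHomogeneous_one _ _, isHomogeneous_one _ _, one_ne_zero, one_ne_zero⟩
  · intro i j p hp
    have h := (LineBundle.tautCoef_ofCoef (isOpen_chart := hopen) (cover := hcover) (hne := hne)
      (hreg := hreg) (hmk := hmk)).trans i j p hp
    have hi := hne i p hp.1
    rw [← div_eq_iff hi] at h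
    rw [← h]
    obtain _ | _ := i <;> obtain _ | _ := j
    · have h1 := (hpre p).1 hp.1
      simp only [lam, Bool.false_eq_true, if_false]
      field_simp [h1.1, h1.2]
    · have h1 := (hpre p).1 hp.1
      have h2 := hX p hp.2
      have : val 1 p = 1 := by simp [val]
      simp only [lam, Bool.false_eq_true, if_false, if_true, val_mul, this]
      field_simp [h1.1, h1.2]
    · have h1 := (hpre p).1 hp.2
      have h2 := hX p hp.1
      have : val 1 p = 1 := by simp [val]
      simp only [lam, Bool.false_eq_true, if_false, if_true, val_mul, this]
      field_simp [h1.1, h1.2]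
    · have h2 := hX p hp.1
      simp only [lam, if_true]
      field_simp
  · rintro (_ | _) p hp
    · have h1 := (hpre p).1 hp
      simp only [Bool.false_eq_true, if_false]
      rw [ord_mul p hA0 hX0, ord_eq_zero hA h1.1, ord_eq_zero hB h1.2, ord_X_one]
      by_cases h : p = marked 2
      · simp [h]
      · simp [Finsupp.single_eq_of_ne h]
    · have : p ≠ marked 2 := by rintro rfl; exact hp (proj_marked 2)
      simp [Finsupp.single_eq_of_ne this]

/-! ### Moduli in coordinates, and prescribed values at 0, 1, ∞ -/

theorem exists_rep_mk_eq {ι : Type*} {v : ι → ℂ} (hv : v ≠ 0) :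
    ∃ c : ℂ, c ≠ 0 ∧ ∀ k, (Projectivization.mk ℂ v hv).rep k = c * v k := by
  obtain ⟨a, ha⟩ := Projectivization.exists_smul_eq_mk_rep ℂ v hv
  exact ⟨a, a.ne_zero, fun k => by rw [← ha]; rfl⟩

theorem eq_of_rep_eq_mul {ι : Type*} {P R : ℙ ℂ (ι → ℂ)} {c : ℂ}
    (h : ∀ k, P.rep k = c * R.rep k) : P = R := by
  rw [← P.mk_rep, ← R.mk_rep, Projectivization.mk_eq_mk_iff']
  exact ⟨c, (funext h).symm⟩

theorem exists_markedVec_eq : ∃ γ : Fin 3 → ℂ, (∀ k, γ k ≠ 0) ∧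
    ∀ k, markedVec k = γ k • (marked k).rep := by
  have h := fun k => exists_smul_rep (markedVec_ne_zero k)
  choose γ h1 h2 using h
  exact ⟨γ, h1, h2⟩

/-- The moduli of `L` in terms of the values at `0`, `1`, `∞` of one trivialization. -/
theorem LineBundle.TautCoef.isModulus_iff {b : Fin 3 → Fin 2 → ℂ} {β : Fin 3 → ℂ}
    (hβ : ∀ k, b k = β k • (marked k).rep) {L : LineBundle}
    {lam : L.ι → P1 → ℂ} (hl : L.TautCoef lam) {i : L.ι} (hi : triple ∈ L.chart i)
    (P : ℙ ℂ (Fin 3 → ℂ)) :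
    L.IsModulus b P ↔ ∃ c : ℂ, c ≠ 0 ∧ ∀ k, P.rep k * β k = c * lam i (marked k) := by
  constructor
  · rintro ⟨s, hs, j, hj, a, ha, hsa, rfl⟩
    obtain ⟨mu, hm, hsm⟩ := hs.exists_tautCoef
    obtain ⟨c, hc, hcl⟩ := hl.exists_eq_mul hm
    obtain ⟨d, hd, hda⟩ := exists_rep_mk_eq ha
    refine ⟨d * c * L.g i j triple, mul_ne_zero (mul_ne_zero hd hc) (L.g_ne_zero _ _ _ ⟨hi, hj⟩),
      fun k => ?_⟩
    have h1 := hsm j (marked k) (by rw [proj_marked]; exact hj)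
    rw [hsa, hβ, smul_smul] at h1
    have h2 : a k * β k = mu j (marked k) :=
      smul_left_injective ℂ (marked k).rep_nonzero h1
    have h3 := hl.trans i j (marked k) (by rw [proj_marked]; exact ⟨hi, hj⟩)
    rw [hda, mul_assoc, h2, hcl j _ (by rw [proj_marked]; exact hj), h3, proj_marked]
    ring
  · rintro ⟨c, hc, h⟩
    refine ⟨_, (hl.const_mul hc).isTautIso, i, hi, P.rep, P.rep_nonzero, fun k => ?_, P.mk_rep.symm⟩
    rw [hβ, smul_smul, h]

theorem exists_quadratic_form (w : Fin 3 → ℂ) : ∃ A : MvPolynomial (Fin 2) ℂ,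
    A.IsHomogeneous 2 ∧ ∀ k, val A (marked k) = w k := by
  obtain ⟨γ, hγ, h⟩ := exists_markedVec_eq
  -- `γ k ^ 2` passes from the chosen representative to `markedVec k` in degree 2; `A` then
  -- interpolates `z` at (0,1), (1,1), (1,0).
  let z : Fin 3 → ℂ := fun k => γ k ^ 2 * w k
  let A : MvPolynomial (Fin 2) ℂ := C (z 2) * (X 0 * X 0) + C (z 1 - z 0 - z 2) * (X 0 * X 1)
    + C (z 0) * (X 1 * X 1)
  have hX : ∀ i j : Fin 2, (X i * X j : MvPolynomial (Fin 2) ℂ).IsHomogeneous 2 := fun i j =>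
    (isHomogeneous_X ℂ i).mul (isHomogeneous_X ℂ j)
  have hA : A.IsHomogeneous 2 := (((hX 0 0).C_mul _).add ((hX 0 1).C_mul _)).add ((hX 1 1).C_mul _)
  refine ⟨A, hA, fun k => mul_left_cancel₀ (pow_ne_zero 2 (hγ k)) ?_⟩
  have h1 := eval_smul_eq hA (γ k) (marked k).rep
  rw [← h] at h1
  refine h1.symm.trans ?_
  change _ = z k
  fin_cases k <;> simp [A, markedVec]

theorem exists_lineBundle (w : Fin 3 → ℂ) (hw : ∀ k, w k ≠ 0) :
    ∃ L : LineBundle, L.HasDegree (-1) ∧ ∃ lam, L.TautCoef lam ∧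
      ∃ i, triple ∈ L.chart i ∧ ∀ k, lam i (marked k) = w k := by
  -- `B` vanishes only at the affine point 2, which is not marked. The cube makes its degree one
  -- more than that of the interpolating quadratic form.
  let B : MvPolynomial (Fin 2) ℂ := (X 0 - C 2 * X 1) ^ 3
  have hB : B.IsHomogeneous 3 := by
    simpa using ((isHomogeneous_X ℂ (0 : Fin 2)).sub ((isHomogeneous_X ℂ (1 : Fin 2)).C_mul 2)).pow 3
  have hBm : ∀ k, val B (marked k) ≠ 0 := by
    intro k
    rw [val_marked_ne_zero_iff hB]
    fin_cases k <;> simp [B, markedVec]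
    norm_num
  obtain ⟨A, hA, hAw⟩ := exists_quadratic_form fun k => w k * val B (marked k)
  have hAm : ∀ k, val A (marked k) ≠ 0 := fun k => by
    rw [hAw]; exact mul_ne_zero (hw k) (hBm k)
  obtain ⟨L, hL, lam, hl, i, hi, h⟩ := exists_lineBundle_of_forms hA hB hAm hBm
  refine ⟨L, hL, lam, hl, i, hi, fun k => ?_⟩
  rw [h, hAw, mul_div_cancel_right₀ _ (hBm k)]

/-- `L(x)` is trivial if and only if the modulus of `L` is that of `𝒪(-x)`. -/
theorem LineBundle.TautCoef.twist_isomorphic_iff {L : LineBundle}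
    {lam : L.ι → P1 → ℂ} (hl : L.TautCoef lam) {i : L.ι} (hi : triple ∈ L.chart i)
    (x : {c : Curve // c ≠ triple}) :
    (L.twist x).Isomorphic LineBundle.trivial ↔
      ∃ c : ℂ, c ≠ 0 ∧ ∀ k, lam i (marked k) * val (linForm (lift x.1)) (marked k) = c := by
  have h0 : ∀ k, val (linForm (lift x.1)) (marked k) ≠ 0 := fun k =>
    val_pointForm_ne_zero x.2 (β := false) fun h => x.2 (h.symm.trans (proj_marked k))
  constructor
  · intro h
    obtain ⟨mu, hm, hmc⟩ := LineBundle.exists_tautCoef_of_twist h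
    obtain ⟨c, hc, hmk⟩ := hmc i hi
    obtain ⟨d, hd, hlm⟩ := hm.exists_eq_mul hl
    refine ⟨d * c, mul_ne_zero hd hc, fun k => ?_⟩
    rw [hlm i _ (by rw [proj_marked]; exact hi), hmk, mul_assoc, div_mul_cancel₀ _ (h0 k)]
  · rintro ⟨c, hc, h⟩
    exact hl.twist_isomorphic hi (c := c) fun k => by rw [eq_div_iff (h0 k), h]

/-! ### The conic and the points with L(x) trivial -/

/-- The conic `e₀e₂X₀X₂ = e₁e₂X₁X₂ + e₀e₁X₀X₁`. -/
noncomputable def conic (e : Fin 3 → ℂ) : MvPolynomial (Fin 3) ℂ :=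
  (C (e 0 * e 2) * X 2 - C (e 0 * e 1) * X 1) * X 0 + C (-(e 1 * e 2)) * (X 1 * X 2)

theorem eval_conic (e v : Fin 3 → ℂ) : eval v (conic e) =
    (v 0 * e 0) * (v 2 * e 2) - (v 1 * e 1) * (v 2 * e 2) - (v 0 * e 0) * (v 1 * e 1) := by
  simp [conic]
  ring

theorem conic_isHomogeneous (e : Fin 3 → ℂ) : (conic e).IsHomogeneous 2 := by
  have hX : ∀ i : Fin 3, (X i : MvPolynomial (Fin 3) ℂ).IsHomogeneous 1 := isHomogeneous_X ℂ
  exact ((((hX 2).C_mul _).sub ((hX 1).C_mul _)).mul (hX 0)).add (((hX 1).mul (hX 2)).C_mul _)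

/-- The form is linear in `X 0`. Its leading coefficient is prime to `X 1` and to `X 2`, hence to
the remaining term, a constant multiple of `X 1 * X 2`. -/
theorem conic_irreducible {e : Fin 3 → ℂ} (he : ∀ k, e k ≠ 0) : Irreducible (conic e) := by
  set f : MvPolynomial (Fin 3) ℂ := C (e 0 * e 2) * X 2 - C (e 0 * e 1) * X 1 with hf
  have h1 : eval ![0, 0, 1] f ≠ 0 := by simp [hf, he]
  have h2 : eval ![0, 1, 0] f ≠ 0 := by simp [hf, he]
  have hX : ∀ (i : Fin 3) (v : Fin 3 → ℂ), v i = 0 → eval v f ≠ 0 → IsRelPrime f (X i) := by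
    intro i v hv hfv
    refine ((X_prime (R := ℂ) (i := i)).irreducible.isRelPrime_iff_not_dvd.2 ?_).symm
    rintro ⟨q, hq⟩
    apply hfv
    rw [hq]
    simp [hv]
  have hu : IsUnit (C (-(e 1 * e 2)) : MvPolynomial (Fin 3) ℂ) :=
    (isUnit_iff_ne_zero.2 (neg_ne_zero.2 (mul_ne_zero (he 1) (he 2)))).map C
  refine irreducible_mul_X_add f _ 0 (fun h => h1 (by rw [h, map_zero])) (fun h => ?_)
    (fun h => ?_) ?_
  · have := vars_sub_subset _ h
    rw [vars_C_mul _ (mul_ne_zero (he 0) (he 2)), vars_C_mul _ (mul_ne_zero (he 0) (he 1))] at this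
    simp at this
  · rw [vars_C_mul _ (neg_ne_zero.2 (mul_ne_zero (he 1) (he 2)))] at h
    have := vars_mul _ _ h
    simp at this
  · rw [isRelPrime_mul_unit_left_right hu]
    exact (hX 1 _ rfl h1).mul_right (hX 2 _ rfl h2)

theorem eq_coordPoint {P : ℙ ℂ (Fin 3 → ℂ)} {k : Fin 3} (h : ∀ j, j ≠ k → P.rep j = 0) :
    P = coordPoint k := by
  rw [coordPoint, ← P.mk_rep, Projectivization.mk_eq_mk_iff']
  refine ⟨P.rep k, ?_⟩
  ext j
  by_cases hj : j = k
  · subst hj; simp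
  · simp [h j hj, hj]

theorem coordPoint_mem_zeroLocus (e : Fin 3 → ℂ) (k : Fin 3) :
    coordPoint k ∈ zeroLocus (conic e) := by
  obtain ⟨c, hc, h⟩ := exists_rep_mk_eq (v := Pi.single k (1 : ℂ))
    (Pi.single_ne_zero_iff.2 one_ne_zero)
  change eval (coordPoint k).rep (conic e) = 0
  rw [eval_conic]
  change ∀ j, (coordPoint k).rep j = _ at h
  rw [h, h, h]
  fin_cases k <;> simp

/-- Once one coordinate is zero, the equation reduces to the vanishing of the product of the other
two. -/
theorem eq_coordPoint_of_mem_zeroLocus {e : Fin 3 → ℂ} (he : ∀ k, e k ≠ 0)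
    {P : ℙ ℂ (Fin 3 → ℂ)} (hP : P ∈ zeroLocus (conic e)) (h : ∃ k, P.rep k = 0) :
    ∃ k, P = coordPoint k := by
  obtain ⟨k, hk⟩ := h
  change eval P.rep (conic e) = 0 at hP
  rw [eval_conic] at hP
  have key : ∃ j, ∀ i, i ≠ j → P.rep i = 0 := by
    fin_cases k <;> simp only [Fin.zero_eta, Fin.mk_one, Fin.reduceFinMk] at hk <;>
      simp only [hk, zero_mul, mul_zero, sub_zero, zero_sub, neg_eq_zero, mul_eq_zero, he,
        or_false] at hP <;> rcases hP with hP | hP <;>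
      simp only [Fin.exists_fin_succ, Fin.forall_fin_succ] <;> simp [hk, hP]
  obtain ⟨j, hj⟩ := key
  exact ⟨j, eq_coordPoint hj⟩

/-- The points of the conic with nonzero coordinates are the moduli of the bundles `𝒪(-x)`. -/
theorem exists_point_iff {u : Fin 3 → ℂ} (hu : ∀ k, u k ≠ 0) :
    u 0 * u 2 - u 1 * u 2 - u 0 * u 1 = 0 ↔ ∃ x : {c : Curve // c ≠ triple},
      ∃ c : ℂ, c ≠ 0 ∧ ∀ k, u k * eval (markedVec k) (linForm (lift x.1)) = c := by
  constructor
  · intro h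
    -- The form of `[p₀:p₁]` takes the values `-p₀`, `p₁ - p₀`, `p₁` at the marked vectors. Equality
    -- of the first and last products gives `-p₀ u₀ = p₁ u₂`, solved by this vector; the middle one
    -- then requires the conic equation.
    have hv : (![-u 2, u 0] : Fin 2 → ℂ) ≠ 0 := fun h => hu 0 (by simpa using congrFun h 1)
    let p : P1 := Projectivization.mk ℂ _ hv
    obtain ⟨d, hd, hdp⟩ := exists_rep_mk_eq hv
    have h0 : p.rep 0 = d * -u 2 := hdp 0
    have h1 : p.rep 1 = d * u 0 := hdp 1
    have key : ∀ k, u k * eval (markedVec k) (linForm p) = d * (u 0 * u 2) := by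
      intro k
      fin_cases k <;> simp [linForm, markedVec, h0, h1]
      · ring
      · linear_combination -d * h
      · ring
    have hc : d * (u 0 * u 2) ≠ 0 := mul_ne_zero hd (mul_ne_zero (hu 0) (hu 2))
    have hp : proj p ≠ triple := by
      rw [Ne, proj_eq_triple_iff]
      rintro ⟨k, hk⟩
      have h2 := (val_mk_eq_zero_iff (linForm_isHomogeneous p) (markedVec_ne_zero k)).1
        ((val_linForm_eq_zero_iff p _).2 hk)
      exact hc (by rw [← key k, h2, mul_zero])
    exact ⟨⟨proj p, hp⟩, _, hc, by simpa only [lift_proj hp] using key⟩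
  · rintro ⟨x, c, hc, h⟩
    have h0 := h 0
    have h1 := h 1
    have h2 := h 2
    simp only [linForm, markedVec, map_sub, map_mul, eval_C, eval_X, Matrix.cons_val] at h0 h1 h2
    refine (mul_eq_zero.1 (?_ : c * _ = 0)).resolve_left hc
    linear_combination -u 0 * u 2 * h1 + u 1 * u 2 * h0 + u 0 * u 1 * h2

/-- The two linear forms are proportional at (0,1) and (1,0), hence have proportional coefficients
and the same zero. -/
theorem point_unique {u : Fin 3 → ℂ} (hu : ∀ k, u k ≠ 0) {x y : {c : Curve // c ≠ triple}}
    {c d : ℂ} (hd : d ≠ 0)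
    (hx : ∀ k, u k * eval (markedVec k) (linForm (lift x.1)) = c)
    (hy : ∀ k, u k * eval (markedVec k) (linForm (lift y.1)) = d) : x = y := by
  have key : ∀ k, eval (markedVec k) (linForm (lift x.1))
      = c / d * eval (markedVec k) (linForm (lift y.1)) := by
    intro k
    rw [eq_comm, div_mul_eq_mul_div, div_eq_iff hd]
    refine mul_left_cancel₀ (hu k) ?_
    linear_combination c * hy k - d * hx k
  have h0 := key 0
  have h2 := key 2
  simp only [linForm, markedVec, map_sub, map_mul, eval_C, eval_X, Matrix.cons_val] at h0 h2
  have : lift x.1 = lift y.1 := by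
    refine eq_of_rep_eq_mul (c := c / d) (Fin.forall_fin_two.2 ⟨?_, ?_⟩)
    · linear_combination -h0
    · linear_combination h2
  rw [Subtype.ext_iff, ← proj_lift x.1, this, proj_lift]

theorem exists_coeff_of_mem_submodule {b : Fin 3 → Fin 2 → ℂ}
    (hb : ∀ k, b k ∈ (marked k).submodule ∧ b k ≠ 0) :
    ∃ β : Fin 3 → ℂ, (∀ k, β k ≠ 0) ∧ ∀ k, b k = β k • (marked k).rep := by
  have h : ∀ k, ∃ a : ℂ, a • (marked k).rep = b k := fun k => by
    rw [← Submodule.mem_span_singleton, ← Projectivization.submodule_eq]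
    exact (hb k).1
  choose β hβ using h
  exact ⟨β, fun k h0 => (hb k).2 (by rw [← hβ, h0, zero_smul]), fun k => (hβ k).symm⟩

/-- `L(x)` is trivial if and only if the modulus of `L` is that of `𝒪(-x)`. -/
theorem LineBundle.TautCoef.twist_isomorphic_iff_of_isModulus {b : Fin 3 → Fin 2 → ℂ}
    {β γ : Fin 3 → ℂ} (hβ : ∀ k, b k = β k • (marked k).rep) (hγ0 : ∀ k, γ k ≠ 0)
    (hγ : ∀ k, markedVec k = γ k • (marked k).rep) {L : LineBundle} {lam : L.ι → P1 → ℂ}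
    (hl : L.TautCoef lam) {P : ℙ ℂ (Fin 3 → ℂ)} (hP : L.IsModulus b P)
    (x : {c : Curve // c ≠ triple}) :
    (L.twist x).Isomorphic LineBundle.trivial ↔ ∃ c : ℂ, c ≠ 0 ∧
      ∀ k, P.rep k * (β k / γ k) * MvPolynomial.eval (markedVec k) (linForm (lift x.1)) = c := by
  obtain ⟨i, hi⟩ := L.cover triple
  obtain ⟨d, hd, hPd⟩ := (hl.isModulus_iff hβ hi P).1 hP
  have key : ∀ k, P.rep k * (β k / γ k) * MvPolynomial.eval (markedVec k) (linForm (lift x.1))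
      = d * (lam i (marked k) * val (linForm (lift x.1)) (marked k)) := by
    intro k
    have h1 := hγ0 k
    rw [hγ, eval_smul_eq (linForm_isHomogeneous _), val, ← mul_assoc d, ← hPd]
    field_simp
  simp only [hl.twist_isomorphic_iff hi, key]
  constructor
  · rintro ⟨c, hc, h⟩
    exact ⟨d * c, mul_ne_zero hd hc, fun k => by rw [h]⟩
  · rintro ⟨c, hc, h⟩
    exact ⟨c / d, div_ne_zero hc hd, fun k => by rw [← h k, mul_div_cancel_left₀ _ hd]⟩

end TripleCurve

/-! ### The moduli bijection and the conic for arbitrary fibre bases -/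

open TripleCurve in
theorem mainTheorem7 (b : Fin 3 → Fin 2 → ℂ)
    (hb : ∀ k, b k ∈ (marked k).submodule ∧ b k ≠ 0) :
    (∀ L : LineBundle, L.HasDegree (-1) → ∃! P, L.IsModulus b P) ∧
    (∀ P : ℙ ℂ (Fin 3 → ℂ),
      (∃ L : LineBundle, L.HasDegree (-1) ∧ L.IsModulus b P) ↔ ∀ k, P.rep k ≠ 0) ∧
    (∀ (L M : LineBundle) (P R : ℙ ℂ (Fin 3 → ℂ)), L.HasDegree (-1) → M.HasDegree (-1) →
      L.IsModulus b P → M.IsModulus b R → (L.Isomorphic M ↔ P = R)) ∧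
    (∀ (L : LineBundle) (x y : {c : Curve // c ≠ triple}), L.HasDegree (-1) →
      (L.twist x).Isomorphic LineBundle.trivial → (L.twist y).Isomorphic LineBundle.trivial →
      x = y) ∧
    ∃ Q : MvPolynomial (Fin 3) ℂ, Q.IsHomogeneous 2 ∧ Irreducible Q ∧
      (∀ k, coordPoint k ∈ zeroLocus Q) ∧
      (∀ (L : LineBundle) (P : ℙ ℂ (Fin 3 → ℂ)), L.HasDegree (-1) → L.IsModulus b P →
        (P ∈ zeroLocus Q ↔
          ∃! x : {c : Curve // c ≠ triple}, (L.twist x).Isomorphic LineBundle.trivial)) ∧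
      (∀ P ∈ zeroLocus Q, (∃ k, P.rep k = 0) → ∃ k, P = coordPoint k) := by
  obtain ⟨β, hβ0, hβ⟩ := exists_coeff_of_mem_submodule hb
  obtain ⟨γ, hγ0, hγ⟩ := exists_markedVec_eq
  have hmk : ∀ {L : LineBundle} {lam : L.ι → P1 → ℂ}, L.TautCoef lam → ∀ {i},
      triple ∈ L.chart i → ∀ k, lam i (marked k) ≠ 0 := fun hl i hi k =>
    hl.ne_zero i _ (by rw [proj_marked]; exact hi)
  have hex : ∀ L : LineBundle, L.HasDegree (-1) → ∃ P, L.IsModulus b P := by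
    intro L hL
    obtain ⟨lam, hl⟩ := hL.exists_tautCoef
    obtain ⟨i, hi⟩ := L.cover triple
    -- Dividing by `β k` expresses the image of the frame in the basis `b k` instead of the chosen
    -- representative.
    have ha : (fun k => lam i (marked k) / β k) ≠ 0 := fun h =>
      div_ne_zero (hmk hl hi 0) (hβ0 0) (congrFun h 0)
    obtain ⟨c, hc, h⟩ := exists_rep_mk_eq ha
    refine ⟨Projectivization.mk ℂ _ ha, (hl.isModulus_iff hβ hi _).2 ⟨c, hc, fun k => ?_⟩⟩
    rw [h, mul_assoc, div_mul_cancel₀ _ (hβ0 k)]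
  have hne : ∀ (L : LineBundle) (P : ℙ ℂ (Fin 3 → ℂ)), L.HasDegree (-1) → L.IsModulus b P →
      ∀ k, P.rep k ≠ 0 := by
    intro L P hL hP k
    obtain ⟨lam, hl⟩ := hL.exists_tautCoef
    obtain ⟨i, hi⟩ := L.cover triple
    obtain ⟨c, hc, h⟩ := (hl.isModulus_iff hβ hi P).1 hP
    refine left_ne_zero_of_mul (b := β k) ?_
    rw [h]
    exact mul_ne_zero hc (hmk hl hi k)
  have heq : ∀ {P R : ℙ ℂ (Fin 3 → ℂ)} {c : ℂ}, (∀ k, P.rep k * β k = c * (R.rep k * β k)) →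
      P = R := fun h => eq_of_rep_eq_mul fun k => mul_right_cancel₀ (hβ0 k) ((h k).trans (by ring))
  have hiso : ∀ (L M : LineBundle) (P R : ℙ ℂ (Fin 3 → ℂ)), L.HasDegree (-1) → M.HasDegree (-1) →
      L.IsModulus b P → M.IsModulus b R → (L.Isomorphic M ↔ P = R) := by
    intro L M P R hL hM hP hR
    obtain ⟨i, hi⟩ := L.cover triple
    obtain ⟨a, ha⟩ := M.cover triple
    obtain ⟨mu, hm⟩ := hM.exists_tautCoef
    obtain ⟨d, hd, hRd⟩ := (hm.isModulus_iff hβ ha R).1 hR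
    constructor
    · intro h
      obtain ⟨lam, hl, hlm⟩ := h.exists_tautCoef hm
      obtain ⟨c, hc, hcl⟩ := hlm i a hi ha
      obtain ⟨e, he, hPe⟩ := (hl.isModulus_iff hβ hi P).1 hP
      refine heq (c := e * c / d) fun k => ?_
      rw [hPe, hRd, hcl]
      field_simp
    · rintro rfl
      obtain ⟨lam, hl⟩ := hL.exists_tautCoef
      obtain ⟨e, he, hPe⟩ := (hl.isModulus_iff hβ hi P).1 hP
      refine hl.isomorphic hm hi ha (c := d / e) fun k => ?_
      rw [div_mul_eq_mul_div, ← hRd, hPe, mul_div_cancel_left₀ _ he]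
  have hu : ∀ (L : LineBundle) (P : ℙ ℂ (Fin 3 → ℂ)), L.HasDegree (-1) → L.IsModulus b P →
      ∀ k, P.rep k * (β k / γ k) ≠ 0 := fun L P hL hP k =>
    mul_ne_zero (hne L P hL hP k) (div_ne_zero (hβ0 k) (hγ0 k))
  have huniq : ∀ (L : LineBundle) (x y : {c : Curve // c ≠ triple}), L.HasDegree (-1) →
      (L.twist x).Isomorphic LineBundle.trivial → (L.twist y).Isomorphic LineBundle.trivial →
      x = y := by
    intro L x y hL hx hy
    obtain ⟨P, hP⟩ := hex L hL
    obtain ⟨lam, hl⟩ := hL.exists_tautCoef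
    obtain ⟨c, -, hc⟩ := (hl.twist_isomorphic_iff_of_isModulus hβ hγ0 hγ hP x).1 hx
    obtain ⟨d, hd, hd'⟩ := (hl.twist_isomorphic_iff_of_isModulus hβ hγ0 hγ hP y).1 hy
    exact point_unique (hu L P hL hP) hd hc hd'
  -- The ratio `β k / γ k` converts coordinates in the basis `b k` to coordinates in `markedVec k`;
  -- these ratios are the coefficients of the conic.
  have he : ∀ k, β k / γ k ≠ 0 := fun k => div_ne_zero (hβ0 k) (hγ0 k)
  refine ⟨fun L hL => ?_, fun P => ⟨?_, fun h => ?_⟩, hiso, huniq, conic fun k => β k / γ k,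
    conic_isHomogeneous _, conic_irreducible he, coordPoint_mem_zeroLocus _, fun L P hL hP => ?_,
    fun P => eq_coordPoint_of_mem_zeroLocus he⟩
  · obtain ⟨P, hP⟩ := hex L hL
    obtain ⟨lam, hl⟩ := hL.exists_tautCoef
    obtain ⟨i, hi⟩ := L.cover triple
    refine ⟨P, hP, fun R hR => ?_⟩
    obtain ⟨c, hc, hPc⟩ := (hl.isModulus_iff hβ hi P).1 hP
    obtain ⟨d, hd, hRd⟩ := (hl.isModulus_iff hβ hi R).1 hR
    refine heq (c := d / c) fun k => ?_
    rw [hPc, hRd]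
    field_simp
  · rintro ⟨L, hL, hP⟩
    exact hne L P hL hP
  · obtain ⟨L, hL, lam, hl, i, hi, hlam⟩ :=
      exists_lineBundle (fun k => P.rep k * β k) fun k => mul_ne_zero (h k) (hβ0 k)
    exact ⟨L, hL, (hl.isModulus_iff hβ hi P).2 ⟨1, one_ne_zero, fun k => by rw [hlam, one_mul]⟩⟩
  · obtain ⟨lam, hl⟩ := hL.exists_tautCoef
    change MvPolynomial.eval P.rep (conic _) = 0 ↔ _
    rw [eval_conic, exists_point_iff (hu L P hL hP)]
    simp only [← hl.twist_isomorphic_iff_of_isModulus hβ hγ0 hγ hP]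
    exact ⟨fun ⟨x, hx⟩ => ⟨x, hx, fun y hy => huniq L y x hL hy hx⟩, fun ⟨x, hx, _⟩ => ⟨x, hx⟩⟩
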